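/- Let $V=(V,\le,\otimes,k)$ be a commutative unital quantale: a complete lattice with a commutative monoid structure such that $\otimes$ preserves arbitrary suprema in each variable. **$V$-modules.** $V\text{-}\mathtt{Mod}$ is the category of suplattices (complete lattices) $X$ with an action $\rho\colon V\times X\to X$, $(v,x)\mapsto v\cdot x$, of the monoid $(V,\otimes,k)$ that preserves suprema in each variable (equivalently, $\rho\colon V\otimes_{\mathbf 2}X\to X$, where $\otimes_{\mathbf 2}$ is the tensor product of the category $\mathtt{Sup}$ of suplattices, $X\otimes_{\mathbf 2}Y=\{C\subseteq X\times Y \mid \text{for all } A,B:\ A\times B\subseteq C \Leftrightarrow (\bigvee A,\bigvee B)\in C\}$ ordered by inclusion); morphisms are the equivariant suprema-preserving maps. The Joyal–Tierney tensor product $X\otimes_V Y$ is the coequalizer in $\mathtt{Sup}$ of the two maps $V\otimes_{\mathbf 2}X\otimes_{\mathbf 2}Y\rightrightarrows X\otimes_{\mathbf 2}Y$, $v\otimes x\otimes y\mapsto (v\cdot x)\otimes y$ and $v\otimes x\otimes y\mapsto x\otimes(v\cdot y)$, with the action $v\cdot(x\otimes y)=(v\cdot x)\otimes y$. The unit is $V$.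 **$P_V$-algebras.** $P_V$ is the $V$-powerset monad on $\mathtt{Set}$: $P_VX=V^X$, $P_Vf(\varphi)(y)=\bigvee_{f(x)=y}\varphi(x)$, unit $e_X(x)(x')=k$ if $x=x'$ and $\bot$ otherwise, multiplication $n_X(\Phi)(x)=\bigvee_{\varphi}\Phi(\varphi)\otimes\varphi(x)$. $\mathtt{Set}^{P_V}$ is its Eilenberg–Moore category. For algebras $(X,\alpha),(Y,\beta)$ the tensor product $X\otimes_{P_V}Y$ is the coequalizer in $\mathtt{Set}^{P_V}$ of the two maps $P_V(P_VX\times P_VY)\rightrightarrows P_V(X\times Y)$ given by $n_{X\times Y}\circ P_V(\boxtimes)$, where $(\varphi\boxtimes\psi)(x,y)=\varphi(x)\otimes\psi(y)$, and by $P_V(\alpha\times\beta)$; $x\otimes y$ is the image of $e_{X\times Y}(x,y)$. The unit is $P_V(1)$. **Monoidal structures.** In either category a *bimorphism* $X\times Y\to Z$ is a function that is a morphism in each variable separately, and a *universal* bimorphism $X\times Y\to T$ is one through which every bimorphism $X\times Y\to Z$ factors by a unique morphism $T\to Z$. The monoidal structure has $(f\otimes g)(x\otimes y)=f(x)\otimes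 g(y)$ and associator $(x\otimes y)\otimes z\mapsto x\otimes(y\otimes z)$. The left unitor corresponds to the bimorphism $(v,x)\mapsto v\cdot x$ in $V\text{-}\mathtt{Mod}$ and to $(v,x)\mapsto\alpha(v\boxtimes e_X(x))$ in $\mathtt{Set}^{P_V}$ (with $1\times X$ identified with $X$), and the right unitor to the same map with the arguments exchanged. **The functor $[-]$.** For a $V$-module $X$ let $a(x,y)=\bigvee\{v\in V\mid v\cdot x\le y\}$, and let $\mathrm{Sup}_X(\varphi)$ be the least $x\in X$ with $\varphi(w)\le a(w,x)$ for all $w$. The functor $[-]\colon V\text{-}\mathtt{Mod}\to\mathtt{Set}^{P_V}$ sends $X$ to the algebra with the same underlying set and structure map $\psi\mapsto \mathrm{Sup}_X(\psi\circ a)$, where $(\psi\circ a)(w)=\bigvee_x a(w,x)\otimes\psi(x)$, and is the identity on underlying functions. **Proposition.** 1. For all $V$-modules $X,Y$ the map $(x,y)\mapsto x\otimes y$, $X\times Y\to X\otimes_VY$, is a universal bimorphism. 2. For all $P_V$-algebras $X,Y$ the map $(x,y)\mapsto x\otimes y$, $X\times Y\to X\otimes_{P_V}Y$, is a universal bimorphism.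 3. The functor $[-]\colon V\text{-}\mathtt{Mod}\to\mathtt{Set}^{P_V}$ is an equivalence of categories. 4. $[-]$ carries the structure of a strong monoidal functor from $(V\text{-}\mathtt{Mod},\otimes_V,V)$ to $(\mathtt{Set}^{P_V},\otimes_{P_V},P_V(1))$ whose structure isomorphisms are $[X]\otimes_{P_V}[Y]\cong[X\otimes_VY]$, $x\otimes y\mapsto x\otimes y$, and $P_V(1)\cong[V]$, $\varphi\mapsto\varphi(*)$; and the functor that it induces on monoids (acting as $[-]$ on underlying objects and morphisms) is an equivalence of categories $$\mathrm{Mon}(V\text{-}\mathtt{Mod},\otimes_V)\simeq\mathrm{Mon}(\mathtt{Set}^{P_V},\otimes_{P_V}).$$ -/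

import Mathlib

open CategoryTheory MonoidalCategory

universe u

namespace QuantaleMod

section Bimorphisms

variable {C : Type (u + 1)} [Category.{u} C] (U : C ⥤ Type u)

/-- A function between underlying sets that underlies a morphism. -/
def IsMor (X Y : C) (f : U.obj X → U.obj Y) : Prop :=
  ∃ h : X ⟶ Y, ∀ x, U.map h x = f x

/-- A bimorphism `X × Y → Z`: a function that is a morphism in each variable separately. -/
structure IsBim (X Y Z : C) (f : U.obj X → U.obj Y → U.obj Z) : Prop where
  left : ∀ x, IsMor U Y Z (fun y => f x y)
  right : ∀ y, IsMor U X Z (fun x => f x y)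

/-- `t : X × Y → T` is a universal bimorphism: it is a bimorphism and every bimorphism
`X × Y → Z` factors through it by a unique morphism `T ⟶ Z`. -/
structure IsUniversalBim (X Y T : C) (t : U.obj X → U.obj Y → U.obj T) : Prop where
  isBim : IsBim U X Y T t
  existsUnique : ∀ (Z : C) (f : U.obj X → U.obj Y → U.obj Z), IsBim U X Y Z f →
    ∃! h : T ⟶ Z, ∀ x y, U.map h (t x y) = f x y

/-- What is needed to make a category of structured sets monoidal by universal bimorphisms:
a tensor product classifying bimorphisms, the existence of internal homs, and a unit object
freely generated by one point `one`, with `act i x` the value at `i` of the morphism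
from the unit that sends `one` to `x`. -/
structure TensorData where
  tens : C → C → C
  tmul : ∀ X Y : C, U.obj X → U.obj Y → U.obj (tens X Y)
  univ : ∀ X Y : C, IsUniversalBim U X Y (tens X Y) (tmul X Y)
  closed : ∀ Y Z : C, ∃ (H : C) (ev : U.obj H → U.obj Y → U.obj Z), IsBim U H Y Z ev ∧
    (∀ a b, (∀ y, ev a y = ev b y) → a = b) ∧
    ∀ (W : C) (f : U.obj W → U.obj Y → U.obj Z), IsBim U W Y Z f →
      ∃ h : W ⟶ H, ∀ w y, ev (U.map h w) y = f w y
  unit : C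
  one : U.obj unit
  act : ∀ X : C, U.obj unit → U.obj X → U.obj X
  act_bim : ∀ X : C, IsBim U unit X X (act X)
  one_act : ∀ (X : C) (x : U.obj X), act X one x = x
  unit_ext : ∀ (X : C) (f g : unit ⟶ X), U.map f one = U.map g one → f = g

variable {U}

theorem map_comp_app {X Y Z : C} (f : X ⟶ Y) (g : Y ⟶ Z) (x : U.obj X) :
    U.map (f ≫ g) x = U.map g (U.map f x) := by simp

theorem map_id_app {X : C} (x : U.obj X) : U.map (𝟙 X) x = x := by simp

theorem IsMor.of_hom {X Y : C} (h : X ⟶ Y) : IsMor U X Y (fun x => U.map h x) :=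
  ⟨h, fun _ => rfl⟩

theorem IsMor.id (X : C) : IsMor U X X (fun x => x) := ⟨𝟙 X, map_id_app⟩

theorem IsMor.comp {X Y Z : C} {f : U.obj X → U.obj Y} {g : U.obj Y → U.obj Z}
    (hg : IsMor U Y Z g) (hf : IsMor U X Y f) : IsMor U X Z (fun x => g (f x)) := by
  obtain ⟨a, ha⟩ := hf
  obtain ⟨b, hb⟩ := hg
  exact ⟨a ≫ b, fun x => by rw [map_comp_app, ha, hb]⟩

theorem hom_ext_app [U.Faithful] {X Y : C} {f g : X ⟶ Y} (h : ∀ x, U.map f x = U.map g x) :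
    f = g := by
  apply U.map_injective
  ext x
  exact h x

namespace TensorData

variable (D : TensorData U)

/-- The morphism classifying a bimorphism. -/
noncomputable def lift {X Y Z : C} (f : U.obj X → U.obj Y → U.obj Z) (hf : IsBim U X Y Z f) :
    D.tens X Y ⟶ Z :=
  ((D.univ X Y).existsUnique Z f hf).choose

theorem lift_tmul {X Y Z : C} (f : U.obj X → U.obj Y → U.obj Z) (hf : IsBim U X Y Z f) (x y) :
    U.map (D.lift f hf) (D.tmul X Y x y) = f x y :=
  ((D.univ X Y).existsUnique Z f hf).choose_spec.1 x y

theorem tmul_left {X Y : C} (x : U.obj X) : IsMor U Y (D.tens X Y) (fun y => D.tmul X Y x y) :=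
  (D.univ X Y).isBim.1 x

theorem tmul_right {X Y : C} (y : U.obj Y) : IsMor U X (D.tens X Y) (fun x => D.tmul X Y x y) :=
  (D.univ X Y).isBim.2 y

theorem ext2 {X Y Z : C} {f g : D.tens X Y ⟶ Z}
    (h : ∀ x y, U.map f (D.tmul X Y x y) = U.map g (D.tmul X Y x y)) : f = g := by
  refine ((D.univ X Y).existsUnique Z (fun x y => U.map g (D.tmul X Y x y)) ⟨fun x => ?_,
    fun y => ?_⟩).unique h (fun _ _ => rfl)
  · exact (IsMor.of_hom g).comp (D.tmul_left x)
  · exact (IsMor.of_hom g).comp (D.tmul_right y)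

theorem isMor_ext2 {X Y Z : C} {f g : U.obj (D.tens X Y) → U.obj Z}
    (hf : IsMor U (D.tens X Y) Z f) (hg : IsMor U (D.tens X Y) Z g)
    (h : ∀ x y, f (D.tmul X Y x y) = g (D.tmul X Y x y)) (t) : f t = g t := by
  obtain ⟨a, ha⟩ := hf
  obtain ⟨b, hb⟩ := hg
  have : a = b := D.ext2 fun x y => by rw [ha, hb, h]
  rw [← ha, ← hb, this]

theorem ext3 {X Y Z W : C} {f g : D.tens (D.tens X Y) Z ⟶ W}
    (h : ∀ x y z, U.map f (D.tmul _ _ (D.tmul _ _ x y) z) = U.map g (D.tmul _ _ (D.tmul _ _ x y) z)) :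
    f = g := by
  refine D.ext2 fun t z => ?_
  exact isMor_ext2 D ((IsMor.of_hom f).comp (D.tmul_right z)) ((IsMor.of_hom g).comp (D.tmul_right z))
    (fun x y => h x y z) t

theorem ext3' {X Y Z W : C} {f g : D.tens X (D.tens Y Z) ⟶ W}
    (h : ∀ x y z, U.map f (D.tmul _ _ x (D.tmul _ _ y z)) = U.map g (D.tmul _ _ x (D.tmul _ _ y z))) :
    f = g := by
  refine D.ext2 fun x t => ?_
  exact isMor_ext2 D ((IsMor.of_hom f).comp (D.tmul_left x)) ((IsMor.of_hom g).comp (D.tmul_left x))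
    (fun y z => h x y z) t

theorem ext4 {X Y Z W T : C} {f g : D.tens (D.tens (D.tens X Y) Z) W ⟶ T}
    (h : ∀ x y z w, U.map f (D.tmul _ _ (D.tmul _ _ (D.tmul _ _ x y) z) w) =
      U.map g (D.tmul _ _ (D.tmul _ _ (D.tmul _ _ x y) z) w)) : f = g := by
  refine D.ext3 fun t z w => ?_
  exact isMor_ext2 D
    ((IsMor.of_hom f).comp ((D.tmul_right w).comp (D.tmul_right z)))
    ((IsMor.of_hom g).comp ((D.tmul_right w).comp (D.tmul_right z)))
    (fun x y => h x y z w) t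

theorem exists_tri {X Y Z W : C} (f : U.obj X → U.obj Y → U.obj Z → U.obj W)
    (h1 : ∀ y z, IsMor U X W (fun x => f x y z)) (h2 : ∀ x z, IsMor U Y W (fun y => f x y z))
    (h3 : ∀ x y, IsMor U Z W (fun z => f x y z)) :
    ∃ h : D.tens (D.tens X Y) Z ⟶ W, ∀ x y z,
      U.map h (D.tmul _ _ (D.tmul _ _ x y) z) = f x y z := by
  obtain ⟨H, ev, hev, hext, hfac⟩ := D.closed Z W
  choose a ha using fun x => hfac Y (fun y z => f x y z) ⟨fun y => h3 x y, fun z => h2 x z⟩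
  choose b hb using fun y => hfac X (fun x z => f x y z) ⟨fun x => h3 x y, fun z => h1 y z⟩
  have hab : ∀ x y, U.map (a x) y = U.map (b y) x := fun x y =>
    hext _ _ fun z => by rw [ha, hb]
  have hbim : IsBim U X Y H (fun x y => U.map (a x) y) :=
    ⟨fun x => IsMor.of_hom (a x), fun y => ⟨b y, fun x => (hab x y).symm⟩⟩
  refine ⟨D.lift (fun t z => ev (U.map (D.lift _ hbim) t) z)
    ⟨fun t => hev.1 _, fun z => (hev.2 z).comp (IsMor.of_hom _)⟩, fun x y z => ?_⟩
  rw [lift_tmul, lift_tmul, ha]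

/-- The symmetry `x ⊗ y ↦ y ⊗ x`. -/
noncomputable def swap (X Y : C) : D.tens X Y ⟶ D.tens Y X :=
  D.lift (fun x y => D.tmul Y X y x) ⟨fun x => D.tmul_right x, fun y => D.tmul_left y⟩

theorem swap_tmul {X Y : C} (x : U.obj X) (y : U.obj Y) :
    U.map (D.swap X Y) (D.tmul X Y x y) = D.tmul Y X y x := D.lift_tmul _ _ x y

theorem exists_assoc (X Y Z : C) : ∃ h : D.tens (D.tens X Y) Z ⟶ D.tens X (D.tens Y Z),
    ∀ x y z, U.map h (D.tmul _ _ (D.tmul _ _ x y) z) = D.tmul _ _ x (D.tmul _ _ y z) :=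
  D.exists_tri (fun x y z => D.tmul _ _ x (D.tmul _ _ y z)) (fun _ _ => D.tmul_right _)
    (fun x z => (D.tmul_left x).comp (D.tmul_right z)) (fun x y => (D.tmul_left x).comp (D.tmul_left y))

theorem exists_assoc_inv (X Y Z : C) : ∃ h : D.tens X (D.tens Y Z) ⟶ D.tens (D.tens X Y) Z,
    ∀ x y z, U.map h (D.tmul _ _ x (D.tmul _ _ y z)) = D.tmul _ _ (D.tmul _ _ x y) z := by
  obtain ⟨h, hh⟩ := D.exists_tri
    (fun (y : U.obj Y) (z : U.obj Z) (x : U.obj X) => D.tmul _ _ (D.tmul _ _ x y) z)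
    (fun z x => (D.tmul_right z).comp (D.tmul_left x)) (fun y x => D.tmul_left _)
    (fun y z => (D.tmul_right z).comp (D.tmul_right y))
  exact ⟨D.swap _ _ ≫ h, fun x y z => by rw [map_comp_app, swap_tmul, hh]⟩

/-- The associator `(x ⊗ y) ⊗ z ↦ x ⊗ (y ⊗ z)`. -/
noncomputable def assoc (X Y Z : C) : D.tens (D.tens X Y) Z ≅ D.tens X (D.tens Y Z) where
  hom := (D.exists_assoc X Y Z).choose
  inv := (D.exists_assoc_inv X Y Z).choose
  hom_inv_id := D.ext3 fun x y z => by
    rw [map_comp_app, (D.exists_assoc X Y Z).choose_spec,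
      (D.exists_assoc_inv X Y Z).choose_spec, map_id_app]
  inv_hom_id := D.ext3' fun x y z => by
    rw [map_comp_app, (D.exists_assoc_inv X Y Z).choose_spec,
      (D.exists_assoc X Y Z).choose_spec, map_id_app]

theorem assoc_tmul {X Y Z : C} (x : U.obj X) (y : U.obj Y) (z : U.obj Z) :
    U.map (D.assoc X Y Z).hom (D.tmul _ _ (D.tmul _ _ x y) z) = D.tmul _ _ x (D.tmul _ _ y z) :=
  (D.exists_assoc X Y Z).choose_spec x y z

/-- The tensor product of morphisms, `x ⊗ y ↦ f x ⊗ g y`. -/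
noncomputable def map {X X' Y Y' : C} (f : X ⟶ X') (g : Y ⟶ Y') : D.tens X Y ⟶ D.tens X' Y' :=
  D.lift (fun x y => D.tmul _ _ (U.map f x) (U.map g y))
    ⟨fun _ => (D.tmul_left _).comp (IsMor.of_hom g), fun _ => (D.tmul_right _).comp (IsMor.of_hom f)⟩

theorem map_tmul {X X' Y Y' : C} (f : X ⟶ X') (g : Y ⟶ Y') (x y) :
    U.map (D.map f g) (D.tmul X Y x y) = D.tmul _ _ (U.map f x) (U.map g y) :=
  D.lift_tmul _ _ x y

theorem isMor_unit_ext {X : C} {f g : U.obj D.unit → U.obj X} (hf : IsMor U D.unit X f)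
    (hg : IsMor U D.unit X g) (h : f D.one = g D.one) (i) : f i = g i := by
  obtain ⟨a, ha⟩ := hf
  obtain ⟨b, hb⟩ := hg
  have : a = b := D.unit_ext X a b (by rw [ha, hb, h])
  rw [← ha, ← hb, this]

theorem act_nat {X Y : C} (f : X ⟶ Y) (i : U.obj D.unit) (x : U.obj X) :
    U.map f (D.act X i x) = D.act Y i (U.map f x) :=
  isMor_unit_ext D ((IsMor.of_hom f).comp ((D.act_bim X).2 x)) ((D.act_bim Y).2 _)
    (by rw [D.one_act, D.one_act]) i

theorem map_id (X Y : C) : D.map (𝟙 X) (𝟙 Y) = 𝟙 (D.tens X Y) := D.ext2 fun x y => by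
  rw [map_tmul, map_id_app, map_id_app, map_id_app]

theorem map_comp {X₁ Y₁ Z₁ X₂ Y₂ Z₂ : C} (f₁ : X₁ ⟶ Y₁) (f₂ : X₂ ⟶ Y₂) (g₁ : Y₁ ⟶ Z₁)
    (g₂ : Y₂ ⟶ Z₂) : D.map f₁ f₂ ≫ D.map g₁ g₂ = D.map (f₁ ≫ g₁) (f₂ ≫ g₂) :=
  D.ext2 fun x y => by simp only [map_comp_app, map_tmul]

theorem assoc_nat {X₁ X₂ X₃ Y₁ Y₂ Y₃ : C} (f₁ : X₁ ⟶ Y₁) (f₂ : X₂ ⟶ Y₂) (f₃ : X₃ ⟶ Y₃) :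
    D.map (D.map f₁ f₂) f₃ ≫ (D.assoc Y₁ Y₂ Y₃).hom =
      (D.assoc X₁ X₂ X₃).hom ≫ D.map f₁ (D.map f₂ f₃) :=
  D.ext3 fun x y z => by simp only [map_comp_app, map_tmul, assoc_tmul]

theorem pentagon (W X Y Z : C) :
    D.map (D.assoc W X Y).hom (𝟙 Z) ≫ (D.assoc W (D.tens X Y) Z).hom ≫
      D.map (𝟙 W) (D.assoc X Y Z).hom =
    (D.assoc (D.tens W X) Y Z).hom ≫ (D.assoc W X (D.tens Y Z)).hom :=
  D.ext4 fun w x y z => by simp only [map_comp_app, map_tmul, assoc_tmul, map_id_app]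

variable [U.Faithful]

/-- The left unitor `i ⊗ x ↦ act i x`. -/
noncomputable def leftU (X : C) : D.tens D.unit X ≅ X where
  hom := D.lift (D.act X) (D.act_bim X)
  inv := (D.tmul_left (X := D.unit) (Y := X) D.one).choose
  hom_inv_id := D.ext2 fun i x => by
    rw [map_comp_app, lift_tmul, (D.tmul_left (X := D.unit) (Y := X) D.one).choose_spec, map_id_app]
    exact isMor_unit_ext D ((D.tmul_left D.one).comp ((D.act_bim X).2 x)) (D.tmul_right x)
      (by rw [D.one_act]) i
  inv_hom_id := hom_ext_app fun x => by
    rw [map_comp_app, (D.tmul_left (X := D.unit) (Y := X) D.one).choose_spec, lift_tmul, D.one_act,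
      map_id_app]

theorem leftU_tmul {X : C} (i : U.obj D.unit) (x : U.obj X) :
    U.map (D.leftU X).hom (D.tmul _ _ i x) = D.act X i x := D.lift_tmul _ (D.act_bim X) i x

/-- The right unitor `x ⊗ i ↦ act i x`. -/
noncomputable def rightU (X : C) : D.tens X D.unit ≅ X where
  hom := D.lift (fun x i => D.act X i x) ⟨(D.act_bim X).2, (D.act_bim X).1⟩
  inv := (D.tmul_right (X := X) (Y := D.unit) D.one).choose
  hom_inv_id := D.ext2 fun x i => by
    rw [map_comp_app, lift_tmul, (D.tmul_right (X := X) (Y := D.unit) D.one).choose_spec, map_id_app]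
    exact isMor_unit_ext D ((D.tmul_right D.one).comp ((D.act_bim X).2 x)) (D.tmul_left x)
      (by rw [D.one_act]) i
  inv_hom_id := hom_ext_app fun x => by
    rw [map_comp_app, (D.tmul_right (X := X) (Y := D.unit) D.one).choose_spec, lift_tmul, D.one_act,
      map_id_app]

theorem rightU_tmul {X : C} (x : U.obj X) (i : U.obj D.unit) :
    U.map (D.rightU X).hom (D.tmul _ _ x i) = D.act X i x :=
  D.lift_tmul (fun x i => D.act X i x) ⟨(D.act_bim X).2, (D.act_bim X).1⟩ x i

theorem leftU_nat {X Y : C} (f : X ⟶ Y) :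
    D.map (𝟙 D.unit) f ≫ (D.leftU Y).hom = (D.leftU X).hom ≫ f := D.ext2 fun i x => by
  simp only [map_comp_app, map_tmul, leftU_tmul, act_nat, map_id_app]

theorem rightU_nat {X Y : C} (f : X ⟶ Y) :
    D.map f (𝟙 D.unit) ≫ (D.rightU Y).hom = (D.rightU X).hom ≫ f := D.ext2 fun x i => by
  simp only [map_comp_app, map_tmul, rightU_tmul, act_nat, map_id_app]

theorem triangle (X Y : C) :
    (D.assoc X D.unit Y).hom ≫ D.map (𝟙 X) (D.leftU Y).hom = D.map (D.rightU X).hom (𝟙 Y) :=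
  D.ext3 fun x i y => by
    simp only [map_comp_app, map_tmul, assoc_tmul, map_id_app, leftU_tmul, rightU_tmul]
    exact isMor_unit_ext D ((D.tmul_left x).comp ((D.act_bim Y).2 y))
      ((D.tmul_right y).comp ((D.act_bim X).2 x)) (by rw [D.one_act, D.one_act]) i

/-- The monoidal structure given by universal bimorphisms: on elements the tensor product of
morphisms is `x ⊗ y ↦ f x ⊗ g y`, the associator is `(x ⊗ y) ⊗ z ↦ x ⊗ (y ⊗ z)`, and the unitors
are `i ⊗ x ↦ act i x` and `x ⊗ i ↦ act i x`. -/
@[reducible]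
noncomputable def monoidal : MonoidalCategory C :=
  letI : MonoidalCategoryStruct C :=
    { tensorObj := D.tens
      whiskerLeft := fun X _ _ f => D.map (𝟙 X) f
      whiskerRight := fun f Y => D.map f (𝟙 Y)
      tensorHom := fun f g => D.map f g
      tensorUnit := D.unit
      associator := D.assoc
      leftUnitor := D.leftU
      rightUnitor := D.rightU }
  MonoidalCategory.ofTensorHom
    (id_tensorHom_id := fun X Y => D.map_id X Y)
    (id_tensorHom := fun _ _ _ _ => rfl)
    (tensorHom_id := fun _ _ => rfl)
    (tensorHom_comp_tensorHom := fun f₁ f₂ g₁ g₂ => D.map_comp f₁ f₂ g₁ g₂)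
    (associator_naturality := fun f₁ f₂ f₃ => D.assoc_nat f₁ f₂ f₃)
    (leftUnitor_naturality := fun f => D.leftU_nat f)
    (rightUnitor_naturality := fun f => D.rightU_nat f)
    (pentagon := fun W X Y Z => D.pentagon W X Y Z)
    (triangle := fun X Y => D.triangle X Y)

end TensorData

end Bimorphisms

section Suplattices

/-- Suplattices: complete lattices, with morphisms the maps preserving all suprema. -/
structure SupLat where
  carrier : Type u
  [str : CompleteLattice carrier]

attribute [instance] SupLat.str

namespace SupLat

instance : CoeSort SupLat.{u} (Type u) := ⟨SupLat.carrier⟩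

instance : Category.{u} SupLat.{u} where
  Hom X Y := sSupHom X Y
  id X := sSupHom.id X
  comp f g := sSupHom.comp g f

/-- The underlying set. -/
abbrev U : SupLat.{u} ⥤ Type u where
  obj X := X
  map {X Y} (f : sSupHom X Y) := TypeCat.ofHom f

theorem map_sSup {X Y : SupLat.{u}} (f : X ⟶ Y) (s : Set X) :
    U.map f (sSup s : X) = (sSup ((fun x : X => (U.map f x : Y)) '' s) : Y) :=
  sSupHom.map_sSup' f s

instance : U.{u}.Faithful where
  map_injective {X Y} f g h := by
    apply sSupHom.ext
    intro x
    exact congrArg (fun k : X.carrier ⟶ Y.carrier => k x) h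

theorem isMor_iff {X Y : SupLat.{u}} (f : X → Y) :
    IsMor U X Y f ↔ ∀ s : Set X, f (sSup s) = sSup (f '' s) := by
  constructor
  · rintro ⟨h, hh⟩ s
    have : (fun x : X => (U.map h x : Y)) = f := funext hh
    have h2 := map_sSup h s
    rw [this] at h2
    exact (hh _).symm.trans h2
  · intro hf
    exact ⟨(⟨f, hf⟩ : sSupHom X Y), fun _ => rfl⟩

theorem isMor_of_gc {X Y : SupLat.{u}} {f : X → Y} {g : Y → X} (h : GaloisConnection f g) :
    IsMor U X Y f :=
  (isMor_iff f).2 fun s => by rw [h.l_sSup, sSup_image]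

/-- The condition `A × B ⊆ C ↔ (⋁ A, ⋁ B) ∈ C` defining elements of the tensor product. -/
def IsTensorClosed {X Y : Type u} [CompleteLattice X] [CompleteLattice Y] (S : Set (X × Y)) :
    Prop :=
  ∀ (A : Set X) (B : Set Y), A ×ˢ B ⊆ S ↔ (sSup A, sSup B) ∈ S

/-- The tensor product of suplattices, ordered by inclusion. -/
def Ten (X Y : Type u) [CompleteLattice X] [CompleteLattice Y] : Type u :=
  {S : Set (X × Y) // IsTensorClosed S}

section Ten

variable {X Y : Type u} [CompleteLattice X] [CompleteLattice Y]

instance : PartialOrder (Ten X Y) := inferInstanceAs (PartialOrder {S : Set (X × Y) // IsTensorClosed S})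

instance : InfSet (Ten X Y) where
  sInf F := ⟨⋂ T ∈ F, T.1, fun A B => by
    simp only [Set.subset_iInter_iff, Set.mem_iInter]
    exact forall₂_congr fun T _ => T.2 A B⟩

instance : CompleteLattice (Ten X Y) := completeLatticeOfInf _ fun F => by
  constructor
  · intro S hS
    exact Set.biInter_subset_of_mem hS
  · intro S hS
    exact Set.subset_iInter₂ fun T hT => hS hT

/-- The pure tensor: the least closed set containing `(x, y)`. -/
def pure (x : X) (y : Y) : Ten X Y := sInf {S | (x, y) ∈ S.1}

theorem pure_le (x : X) (y : Y) (S : Ten X Y) : pure x y ≤ S ↔ (x, y) ∈ S.1 := by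
  constructor
  · intro h
    apply h
    change _ ∈ ⋂ S ∈ _, _
    simp
  · intro h
    exact sInf_le (a := S) h

end Ten

theorem isBim_iff {X Y Z : SupLat.{u}} (f : X → Y → Z) : IsBim U X Y Z f ↔
    (∀ (x : X) (s : Set Y), f x (sSup s) = sSup (f x '' s)) ∧
      ∀ (y : Y) (s : Set X), f (sSup s) y = sSup ((fun x => f x y) '' s) :=
  ⟨fun h => ⟨fun x => (isMor_iff (X := Y) (Y := Z) _).1 (h.1 x),
    fun y => (isMor_iff (X := X) (Y := Z) _).1 (h.2 y)⟩,
   fun h => ⟨fun x => (isMor_iff (X := Y) (Y := Z) _).2 (h.1 x),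
    fun y => (isMor_iff (X := X) (Y := Z) _).2 (h.2 y)⟩⟩

theorem pure_bim (X Y : SupLat.{u}) : IsBim U X Y ⟨Ten X Y⟩ (fun x y => pure x y) := by
  refine (isBim_iff (Z := ⟨Ten X Y⟩) _).2 ⟨?_, ?_⟩
  · intro x s
    refine eq_of_forall_ge_iff fun S => ?_
    have h := S.2 {x} s
    rw [sSup_singleton] at h
    simp only [sSup_le_iff, Set.forall_mem_image, pure_le]
    rw [← h]
    constructor
    · intro h a ha; exact h ⟨rfl, ha⟩
    · rintro h ⟨a, b⟩ ⟨ha, hb⟩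
      cases ha
      exact h hb
  · intro y s
    refine eq_of_forall_ge_iff fun S => ?_
    have h := S.2 s {y}
    rw [sSup_singleton] at h
    simp only [sSup_le_iff, Set.forall_mem_image, pure_le]
    rw [← h]
    constructor
    · intro h a ha; exact h ⟨ha, rfl⟩
    · rintro h ⟨a, b⟩ ⟨ha, hb⟩
      cases hb
      exact h ha

theorem eq_sSup_pure {X Y : SupLat.{u}} (S : Ten X Y) :
    S = sSup ((fun p : X × Y => pure p.1 p.2) '' S.1) := by
  refine eq_of_forall_ge_iff fun T => ?_
  simp only [sSup_le_iff, Set.forall_mem_image, pure_le]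
  rfl

theorem pure_univ (X Y : SupLat.{u}) :
    IsUniversalBim U X Y ⟨Ten X Y⟩ (fun x y => pure x y) := by
  refine ⟨pure_bim X Y, fun Z (f : X → Y → Z) hf => ?_⟩
  obtain ⟨h1, h2⟩ := (isBim_iff f).1 hf
  let r : Z → Ten X Y := fun z => ⟨{p | f p.1 p.2 ≤ z}, fun A B => by
    change _ ↔ f (sSup A) (sSup B) ≤ z
    rw [h2 (sSup B) A]
    simp only [sSup_le_iff, Set.forall_mem_image]
    constructor
    · intro h a ha
      rw [h1 a B]
      simp only [sSup_le_iff, Set.forall_mem_image]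
      exact fun b hb => h (Set.mk_mem_prod ha hb)
    · rintro h ⟨a, b⟩ ⟨ha, hb⟩
      have := h ha
      rw [h1 a B] at this
      simp only [sSup_le_iff, Set.forall_mem_image] at this
      exact this hb⟩
  have gc : GaloisConnection (fun S : Ten X Y => ⨆ p ∈ S.1, f p.1 p.2) r := by
    intro S z
    simp only [iSup_le_iff]
    rfl
  obtain ⟨h, hh⟩ := isMor_of_gc (X := ⟨Ten X Y⟩) (Y := Z) gc
  have key : ∀ x y, U.map h (pure x y : Ten X Y) = f x y := by
    intro x y
    refine (hh _).trans ?_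
    refine eq_of_forall_ge_iff fun z => ?_
    refine (gc _ _).trans ?_
    rw [pure_le]
    rfl
  refine ⟨h, key, fun g hg => ?_⟩
  apply hom_ext_app (U := U)
  intro (S : Ten X Y)
  rw [eq_sSup_pure S]
  refine (map_sSup g _).trans (Eq.trans ?_ (map_sSup h _).symm)
  rw [Set.image_image, Set.image_image]
  congr 1
  apply Set.image_congr
  intro p _
  exact (hg _ _).trans (key _ _).symm

section Hom

variable {X Y : Type u} [CompleteLattice X] [CompleteLattice Y]

instance : SupSet (sSupHom X Y) where
  sSup F := ⟨fun x => ⨆ f ∈ F, f x, fun s => by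
    refine eq_of_forall_ge_iff fun z => ?_
    simp only [sSupHomClass.map_sSup, sSup_le_iff, iSup_le_iff, Set.forall_mem_image]
    exact ⟨fun h a ha f hf => h f hf ha, fun h f hf a ha => h ha f hf⟩⟩

theorem sSup_hom_apply (F : Set (sSupHom X Y)) (x : X) : (sSup F) x = ⨆ f ∈ F, f x := rfl

/-- Suprema preserving maps with the pointwise order. -/
instance : CompleteLattice (sSupHom X Y) := completeLatticeOfSup _ fun F => by
  constructor
  · intro f hf x
    rw [sSup_hom_apply]
    exact le_iSup₂_of_le f hf le_rfl
  · intro g hg x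
    rw [sSup_hom_apply]
    exact iSup₂_le fun f hf => hg hf x

end Hom

theorem closed (Y Z : SupLat.{u}) :
    ∃ (H : SupLat.{u}) (ev : U.obj H → U.obj Y → U.obj Z), IsBim U H Y Z ev ∧
    (∀ a b, (∀ y, ev a y = ev b y) → a = b) ∧
    ∀ (W : SupLat.{u}) (f : U.obj W → U.obj Y → U.obj Z), IsBim U W Y Z f →
      ∃ h : W ⟶ H, ∀ w y, ev (U.map h w) y = f w y := by
  refine ⟨⟨sSupHom Y Z⟩, fun (h : sSupHom Y Z) y => h y, ?_, fun a b h => sSupHom.ext h, ?_⟩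
  · refine (isBim_iff (X := ⟨sSupHom Y Z⟩) _).2 ⟨fun h => h.map_sSup', fun y s => ?_⟩
    rw [sSup_image]
    rfl
  · intro W (f : W → Y → Z) hf
    obtain ⟨h1, h2⟩ := (isBim_iff f).1 hf
    obtain ⟨h, hh⟩ := (isMor_iff (X := W) (Y := ⟨sSupHom Y Z⟩) (fun w => ⟨f w, h1 w⟩)).2
      fun s => sSupHom.ext fun y => by
        refine (h2 y s).trans ?_
        rw [sSup_hom_apply, iSup_image, sSup_image]
        rfl
    exact ⟨h, fun w y => congrArg (fun k : sSupHom Y Z => k y) (hh w)⟩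

/-- The two-element suplattice `𝟐`, as the free suplattice on one point. -/
abbrev two : SupLat.{u} := ⟨Set PUnit.{u + 1}⟩

/-- The tensor product of suplattices with its universal bimorphism and unit. -/
def tensorData : TensorData U.{u} where
  tens X Y := ⟨Ten X Y⟩
  tmul _ _ := fun x y => pure x y
  univ := pure_univ
  closed := closed
  unit := two
  one := (Set.univ : Set PUnit)
  act X := fun (i : Set PUnit) (x : X) => ⨆ _ : PUnit.unit ∈ i, x
  act_bim X := by
    refine (isBim_iff (X := two) (Y := X) (Z := X) _).2 ⟨fun i s => ?_, fun x s => ?_⟩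
    · by_cases h : PUnit.unit ∈ i <;> simp [h]
      rw [sSup_image]; simp
    · rw [sSup_image]
      refine eq_of_forall_ge_iff fun z => ?_
      simp only [iSup_le_iff, Set.sSup_eq_sUnion, Set.mem_sUnion]
      exact ⟨fun h t ht hu => h ⟨t, ht, hu⟩, fun h ⟨t, ht, hu⟩ => h t ht hu⟩
  one_act X x := by simp
  unit_ext X f g h := by
    apply hom_ext_app (U := U)
    intro (i : Set PUnit)
    by_cases hi : PUnit.unit ∈ i
    · have : i = Set.univ := by ext ⟨⟩; simp [hi]
      rw [this]; exact h
    · have : i = sSup ∅ := by ext ⟨⟩; simp [hi]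
      rw [this]
      refine (map_sSup f _).trans (Eq.trans ?_ (map_sSup g _).symm)
      simp

noncomputable instance : MonoidalCategory SupLat.{u} := tensorData.monoidal

/-- The symmetry `X ⊗ Y ⟶ Y ⊗ X`, `x ⊗ y ↦ y ⊗ x`. -/
noncomputable def swap (X Y : SupLat.{u}) : X ⊗ Y ⟶ Y ⊗ X := tensorData.swap X Y

section Coequalizer

variable {A B : SupLat.{u}} (f g : A ⟶ B)

/-- The coequalizer of `f, g : A ⟶ B`: the elements `b` with `f a ≤ b ↔ g a ≤ b` for all `a`. -/
def Coeq : Type u := {b : B // ∀ a : A, (U.map f a : B) ≤ b ↔ (U.map g a : B) ≤ b}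

instance : PartialOrder (Coeq f g) := 
  inferInstanceAs (PartialOrder {b : B // ∀ a : A, (U.map f a : B) ≤ b ↔ (U.map g a : B) ≤ b})

instance : InfSet (Coeq f g) where
  sInf F := ⟨⨅ c ∈ F, c.1, fun a => by
    simp only [le_iInf_iff]
    exact forall₂_congr fun c _ => c.2 a⟩

instance : CompleteLattice (Coeq f g) := completeLatticeOfInf _ fun F => by
  constructor
  · intro b hb
    exact iInf₂_le (f := fun (b : Coeq f g) (_ : b ∈ F) => b.1) b hb
  · intro b hb
    exact le_iInf₂ fun c hc => hb hc

theorem coeq_gc : GaloisConnection (fun b : B => (sInf {c | b ≤ c.1} : Coeq f g))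
    (fun c : Coeq f g => c.1) := by
  intro b c
  constructor
  · intro h
    refine le_trans ?_ h
    exact le_iInf₂ fun d hd => hd
  · intro h
    exact sInf_le (a := c) h

theorem coeq_exists : ∃ p : B ⟶ (⟨Coeq f g⟩ : SupLat.{u}), f ≫ p = g ≫ p ∧
    ∀ (Z : SupLat.{u}) (h : B ⟶ Z), f ≫ h = g ≫ h → ∃! k : (⟨Coeq f g⟩ : SupLat.{u}) ⟶ Z,
      p ≫ k = h := by
  obtain ⟨p, hp⟩ := isMor_of_gc (X := B) (Y := ⟨Coeq f g⟩) (coeq_gc f g)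
  have hpc : ∀ (b : B) (c : Coeq f g), (U.map p b : Coeq f g) ≤ c ↔ b ≤ c.1 := fun b c => by
    refine Iff.trans ?_ (coeq_gc f g b c)
    exact iff_of_eq (congrArg (· ≤ c) (hp b))
  refine ⟨p, ?_, fun Z h hfg => ?_⟩
  · apply hom_ext_app (U := U)
    intro a
    rw [map_comp_app, map_comp_app]
    refine eq_of_forall_ge_iff (α := Coeq f g) fun c => ?_
    refine (hpc _ _).trans ((c.2 a).trans (hpc _ _).symm)
  · obtain ⟨r, hr⟩ : ∃ r : Z → B, GaloisConnection (fun b : B => (U.map h b : Z)) r := by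
      refine ⟨fun z => sSup {b | (U.map h b : Z) ≤ z}, fun b z => ⟨fun hb => le_sSup hb,
        fun hb => ?_⟩⟩
      have hmono : Monotone (fun b : B => (U.map h b : Z)) := fun x y hxy =>
        OrderHomClass.mono (show sSupHom B Z from h) hxy
      refine (hmono hb).trans ?_
      refine (map_sSup h _).le.trans ?_
      rw [sSup_le_iff]
      rintro _ ⟨b, hb, rfl⟩
      exact hb
    have hfg' : ∀ a : A, (U.map h (U.map f a) : Z) = U.map h (U.map g a) := fun a => by
      have h1 := map_comp_app (U := U) f h a
      have h2 := map_comp_app (U := U) g h a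
      exact (h1.symm.trans (congrArg (fun k => (U.map k a : Z)) hfg)).trans h2
    let r' : Z → Coeq f g := fun z => ⟨r z, fun a =>
      (hr _ _).symm.trans ((iff_of_eq (congrArg (· ≤ z) (hfg' a))).trans (hr _ _))⟩
    obtain ⟨k, hk⟩ := isMor_of_gc (X := ⟨Coeq f g⟩) (Y := Z)
      (f := fun c : Coeq f g => (U.map h c.1 : Z)) (g := r') (fun c z => hr c.1 z)
    have hpk : p ≫ k = h := by
      apply hom_ext_app (U := U)
      intro b
      rw [map_comp_app]
      refine eq_of_forall_ge_iff (α := Z) fun z => ?_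
      refine (iff_of_eq (congrArg (· ≤ z) (hk _))).trans ?_
      refine (hr _ _).trans ?_
      refine Iff.trans ?_ (hr _ _).symm
      exact hpc b (r' z)
    refine ⟨k, hpk, fun k' hk' => ?_⟩
    apply hom_ext_app (U := U)
    intro (c : Coeq f g)
    have hc : (U.map p c.1 : Coeq f g) = c := by
      refine eq_of_forall_ge_iff fun d => ?_
      exact hpc c.1 d
    rw [← hc, ← map_comp_app, ← map_comp_app, hk', hpk]

end Coequalizer

theorem hasCoequalizers : Limits.HasCoequalizers SupLat.{u} := by
  refine @Limits.hasCoequalizers_of_hasColimit_parallelPair _ _ fun {A B f g} => ?_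
  obtain ⟨p, hp, hu⟩ := coeq_exists f g
  exact ⟨⟨⟨Limits.Cofork.ofπ p hp, Limits.Cofork.IsColimit.mk _
    (fun s => (hu s.pt s.π s.condition).choose)
    (fun s => (hu s.pt s.π s.condition).choose_spec.1)
    (fun s m hm => (hu s.pt s.π s.condition).choose_spec.2 m hm)⟩⟩⟩

instance : Limits.HasCoequalizers SupLat.{u} := hasCoequalizers

end SupLat

end Suplattices

section Modules

/-- Modules over a commutative quantale `V`: suplattices with an action of the monoid `V` that
preserves suprema in each variable. -/
structure VMod (V : Type u) [CommMonoid V] [CompleteLattice V] where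
  carrier : Type u
  [lat : CompleteLattice carrier]
  [act : MulAction V carrier]
  smul_sSup : ∀ (v : V) (s : Set carrier), v • sSup s = sSup ((fun x => v • x) '' s)
  sSup_smul : ∀ (s : Set V) (x : carrier), sSup s • x = sSup ((fun v => v • x) '' s)

attribute [instance] VMod.lat VMod.act

namespace VMod

variable {V : Type u} [CommMonoid V] [CompleteLattice V]

instance : CoeSort (VMod V) (Type u) := ⟨VMod.carrier⟩

/-- Equivariant suprema preserving maps. -/
structure Hom (X Y : VMod V) extends sSupHom X Y where
  map_smul : ∀ (v : V) (x : X), toFun (v • x) = v • toFun x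

theorem Hom.ext {X Y : VMod V} {f g : Hom X Y} (h : ∀ x, f.toFun x = g.toFun x) : f = g := by
  cases f; cases g
  congr
  exact sSupHom.ext h

instance : Category.{u} (VMod V) where
  Hom X Y := Hom X Y
  id X := ⟨sSupHom.id X, fun _ _ => rfl⟩
  comp f g := ⟨sSupHom.comp g.tosSupHom f.tosSupHom, fun v x =>
    (congrArg g.toFun (f.map_smul v x)).trans (g.map_smul v _)⟩

/-- The underlying set. -/
abbrev U : VMod V ⥤ Type u where
  obj X := X
  map {X Y} (f : Hom X Y) := TypeCat.ofHom f.toFun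

theorem map_sSup {X Y : VMod V} (f : X ⟶ Y) (s : Set X) :
    U.map f (sSup s : X) = (sSup ((fun x : X => (U.map f x : Y)) '' s) : Y) :=
  (show Hom X Y from f).map_sSup' s

theorem map_smul {X Y : VMod V} (f : X ⟶ Y) (v : V) (x : X) :
    U.map f (v • x : X) = (v • (U.map f x : Y) : Y) :=
  (show Hom X Y from f).map_smul v x

instance : (U (V := V)).Faithful where
  map_injective {X Y} f g h := by
    apply Hom.ext
    intro x
    exact congrArg (fun k : X.carrier ⟶ Y.carrier => k x) h

theorem isMor_iff {X Y : VMod V} (f : X → Y) :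
    IsMor U X Y f ↔ (∀ s : Set X, f (sSup s) = sSup (f '' s)) ∧
      ∀ (v : V) (x : X), f (v • x) = v • f x := by
  constructor
  · rintro ⟨h, hh⟩
    obtain rfl : (fun x : X => (U.map h x : Y)) = f := funext hh
    exact ⟨map_sSup h, map_smul h⟩
  · rintro ⟨h1, h2⟩
    exact ⟨(⟨⟨f, h1⟩, h2⟩ : Hom X Y), fun _ => rfl⟩

theorem isBim_iff {X Y Z : VMod V} (f : X → Y → Z) : IsBim U X Y Z f ↔
    ((∀ (x : X) (s : Set Y), f x (sSup s) = sSup (f x '' s)) ∧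
      ∀ (y : Y) (s : Set X), f (sSup s) y = sSup ((fun x => f x y) '' s)) ∧
    (∀ (v : V) (x : X) (y : Y), f x (v • y) = v • f x y) ∧
      ∀ (v : V) (x : X) (y : Y), f (v • x) y = v • f x y := by
  constructor
  · intro h
    have h1 := fun x => (isMor_iff (X := Y) (Y := Z) _).1 (h.1 x)
    have h2 := fun y => (isMor_iff (X := X) (Y := Z) _).1 (h.2 y)
    exact ⟨⟨fun x => (h1 x).1, fun y => (h2 y).1⟩, fun v x y => (h1 x).2 v y,
      fun v x y => (h2 y).2 v x⟩
  · rintro ⟨⟨h1, h2⟩, h3, h4⟩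
    exact ⟨fun x => (isMor_iff (X := Y) (Y := Z) _).2 ⟨h1 x, fun v y => h3 v x y⟩,
      fun y => (isMor_iff (X := X) (Y := Z) _).2 ⟨h2 y, fun v x => h4 v x y⟩⟩

/-- The underlying suplattice. -/
abbrev toSup (X : VMod V) : SupLat.{u} := ⟨X⟩

variable (V) in
/-- The suplattice `V`. -/
abbrev base : SupLat.{u} := ⟨V⟩

theorem smul_bim (X : VMod V) :
    IsBim SupLat.U (base V) X.toSup X.toSup (fun (v : V) (x : X) => v • x) :=
  (SupLat.isBim_iff (X := base V) (Y := X.toSup) (Z := X.toSup) _).2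
    ⟨X.smul_sSup, fun x s => X.sSup_smul s x⟩

/-- The action as a morphism `V ⊗₂ X ⟶ X` of suplattices. -/
noncomputable def actHom (X : VMod V) : base V ⊗ X.toSup ⟶ X.toSup :=
  SupLat.tensorData.lift (fun (v : V) (x : X) => v • x) X.smul_bim

/-- `v ⊗ x ⊗ y ↦ (v • x) ⊗ y`. -/
noncomputable def jtLeft (X Y : VMod V) :
    (base V ⊗ X.toSup) ⊗ Y.toSup ⟶ X.toSup ⊗ Y.toSup :=
  X.actHom ▷ Y.toSup

/-- `v ⊗ x ⊗ y ↦ x ⊗ (v • y)`. -/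
noncomputable def jtRight (X Y : VMod V) :
    (base V ⊗ X.toSup) ⊗ Y.toSup ⟶ X.toSup ⊗ Y.toSup :=
  (SupLat.swap (base V) X.toSup ▷ Y.toSup) ≫ (α_ X.toSup (base V) Y.toSup).hom ≫
    (X.toSup ◁ Y.actHom)

/-- The underlying suplattice of the Joyal–Tierney tensor product `X ⊗_V Y`, a coequalizer of
suplattices. -/
noncomputable def jt (X Y : VMod V) : SupLat.{u} :=
  Limits.coequalizer (jtLeft X Y) (jtRight X Y)

noncomputable def jtπ (X Y : VMod V) : X.toSup ⊗ Y.toSup ⟶ jt X Y :=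
  Limits.coequalizer.π (jtLeft X Y) (jtRight X Y)

/-- The pure tensor `x ⊗ y`. -/
noncomputable def jtmul (X Y : VMod V) (x : X) (y : Y) : jt X Y :=
  SupLat.U.map (jtπ X Y) (SupLat.tensorData.tmul X.toSup Y.toSup x y)

theorem jtmul_bim (X Y : VMod V) : IsBim SupLat.U X.toSup Y.toSup (jt X Y) (jtmul X Y) :=
  ⟨fun x => (IsMor.of_hom (jtπ X Y)).comp (SupLat.tensorData.tmul_left x),
    fun y => (IsMor.of_hom (jtπ X Y)).comp (SupLat.tensorData.tmul_right y)⟩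

theorem jtLeft_tmul (X Y : VMod V) (v : V) (x : X) (y : Y) :
    SupLat.U.map (jtLeft X Y) (SupLat.tensorData.tmul _ _
      (SupLat.tensorData.tmul (base V) X.toSup v x) y) =
    SupLat.tensorData.tmul X.toSup Y.toSup (v • x : X) y := by
  refine (SupLat.tensorData.map_tmul _ _ _ _).trans ?_
  congr 1
  exact SupLat.tensorData.lift_tmul _ _ _ _

theorem jtRight_tmul (X Y : VMod V) (v : V) (x : X) (y : Y) :
    SupLat.U.map (jtRight X Y) (SupLat.tensorData.tmul _ _
      (SupLat.tensorData.tmul (base V) X.toSup v x) y) =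
    SupLat.tensorData.tmul X.toSup Y.toSup x (v • y : Y) := by
  refine (map_comp_app _ _ _).trans ?_
  rw [map_comp_app]
  have h1 : SupLat.U.map (SupLat.swap (base V) X.toSup ▷ Y.toSup) (SupLat.tensorData.tmul _ _
      (SupLat.tensorData.tmul (base V) X.toSup v x) y) = SupLat.tensorData.tmul _ _
      (SupLat.tensorData.tmul X.toSup (base V) x v) y := by
    refine (SupLat.tensorData.map_tmul _ _ _ _).trans ?_
    congr 1
    exact SupLat.tensorData.swap_tmul _ _
  have h2 : SupLat.U.map (α_ X.toSup (base V) Y.toSup).hom (SupLat.tensorData.tmul _ _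
      (SupLat.tensorData.tmul X.toSup (base V) x v) y) = SupLat.tensorData.tmul _ _ x
      (SupLat.tensorData.tmul (base V) Y.toSup v y) := SupLat.tensorData.assoc_tmul _ _ _
  have h3 : SupLat.U.map (X.toSup ◁ Y.actHom) (SupLat.tensorData.tmul _ _ x
      (SupLat.tensorData.tmul (base V) Y.toSup v y)) =
      SupLat.tensorData.tmul X.toSup Y.toSup x (v • y : Y) := by
    refine (SupLat.tensorData.map_tmul _ _ _ _).trans ?_
    congr 1
    exact SupLat.tensorData.lift_tmul _ _ _ _
  exact (congrArg _ ((congrArg _ h1).trans h2)).trans h3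

theorem jt_ext {X Y : VMod V} {Z : SupLat.{u}} {f g : jt X Y ⟶ Z}
    (h : ∀ x y, SupLat.U.map f (jtmul X Y x y) = SupLat.U.map g (jtmul X Y x y)) : f = g := by
  apply Limits.coequalizer.hom_ext
  refine SupLat.tensorData.ext2 fun x y => ?_
  refine (map_comp_app _ _ _).trans ((h x y).trans (map_comp_app _ _ _).symm)

theorem jt_isMor_ext {X Y : VMod V} {Z : SupLat.{u}} {f g : jt X Y → Z}
    (hf : IsMor SupLat.U (jt X Y) Z f) (hg : IsMor SupLat.U (jt X Y) Z g)
    (h : ∀ x y, f (jtmul X Y x y) = g (jtmul X Y x y)) (t) : f t = g t := by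
  obtain ⟨a, ha⟩ := hf
  obtain ⟨b, hb⟩ := hg
  have : a = b := jt_ext fun x y => (ha _).trans ((h x y).trans (hb _).symm)
  subst this
  exact (ha t).symm.trans (hb t)

theorem jt_balanced {X Y : VMod V} (v : V) (x : X) (y : Y) :
    jtmul X Y (v • x) y = jtmul X Y x (v • y) := by
  have h := congrArg (fun k => SupLat.U.map k (SupLat.tensorData.tmul _ _
      (SupLat.tensorData.tmul (base V) X.toSup v x) y))
    (Limits.coequalizer.condition (jtLeft X Y) (jtRight X Y))
  have h' := (map_comp_app _ _ _).symm.trans (h.trans (map_comp_app _ _ _))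
  refine (congrArg _ (jtLeft_tmul X Y v x y)).symm.trans (h'.trans ?_)
  exact congrArg _ (jtRight_tmul X Y v x y)

theorem jt_lift {X Y : VMod V} {Z : SupLat.{u}} (f : X → Y → Z)
    (hf : IsBim SupLat.U X.toSup Y.toSup Z f) (hb : ∀ (v : V) x y, f (v • x) y = f x (v • y)) :
    ∃ h : jt X Y ⟶ Z, ∀ x y, SupLat.U.map h (jtmul X Y x y) = f x y := by
  have hc : jtLeft X Y ≫ SupLat.tensorData.lift f hf =
      jtRight X Y ≫ SupLat.tensorData.lift f hf := by
    refine SupLat.tensorData.ext3 fun v x y => ?_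
    refine (map_comp_app _ _ _).trans (Eq.trans ?_ (map_comp_app _ _ _).symm)
    refine (congrArg _ (jtLeft_tmul X Y v x y)).trans
      (Eq.trans ?_ (congrArg _ (jtRight_tmul X Y v x y)).symm)
    refine (SupLat.tensorData.lift_tmul _ _ _ _).trans
      (Eq.trans ?_ (SupLat.tensorData.lift_tmul _ _ _ _).symm)
    exact hb v x y
  refine ⟨Limits.coequalizer.desc _ hc, fun x y => ?_⟩
  refine (map_comp_app (jtπ X Y) _ _).symm.trans ?_
  have : jtπ X Y ≫ Limits.coequalizer.desc _ hc = SupLat.tensorData.lift f hf :=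
    Limits.coequalizer.π_desc _ _
  rw [this]
  exact SupLat.tensorData.lift_tmul _ _ _ _

theorem jt_smul_exists (X Y : VMod V) (v : V) : ∃ h : jt X Y ⟶ jt X Y,
    ∀ x y, SupLat.U.map h (jtmul X Y x y) = jtmul X Y (v • x) y := by
  refine jt_lift (fun x y => jtmul X Y (v • x) y) ⟨fun x => (jtmul_bim X Y).1 _, fun y => ?_⟩ ?_
  · exact ((jtmul_bim X Y).2 y).comp (X.smul_bim.1 v)
  · intro w x y
    rw [smul_smul, mul_comm, ← smul_smul, jt_balanced]

/-- The action on `X ⊗_V Y`, with `v • (x ⊗ y) = (v • x) ⊗ y`. -/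
noncomputable instance (X Y : VMod V) : SMul V (jt X Y) where
  smul v t := SupLat.U.map (jt_smul_exists X Y v).choose t

theorem jt_smul_tmul (X Y : VMod V) (v : V) (x : X) (y : Y) :
    v • jtmul X Y x y = jtmul X Y (v • x) y := (jt_smul_exists X Y v).choose_spec x y

theorem jt_smul_isMor (X Y : VMod V) (v : V) :
    IsMor SupLat.U (jt X Y) (jt X Y) (fun t : jt X Y => v • t) := IsMor.of_hom _

noncomputable instance (X Y : VMod V) : MulAction V (jt X Y) where
  one_smul t := jt_isMor_ext (jt_smul_isMor X Y 1) (IsMor.id _)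
    (fun x y => by rw [jt_smul_tmul, one_smul]) t
  mul_smul v w t := jt_isMor_ext (jt_smul_isMor X Y (v * w))
    ((jt_smul_isMor X Y v).comp (jt_smul_isMor X Y w))
    (fun x y => by rw [jt_smul_tmul, jt_smul_tmul, jt_smul_tmul, mul_smul]) t

/-- The Joyal–Tierney tensor product of `V`-modules. -/
noncomputable def tens (X Y : VMod V) : VMod V where
  carrier := jt X Y
  smul_sSup v s := (SupLat.isMor_iff _).1 (jt_smul_isMor X Y v) s
  sSup_smul s t := by
    refine jt_isMor_ext (X := X) (Y := Y) (Z := jt X Y)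
      (f := fun t => sSup s • t) (g := fun t => sSup ((fun v => v • t) '' s))
      (jt_smul_isMor X Y _) ?_ ?_ t
    · refine (SupLat.isMor_iff _).2 fun r => ?_
      refine eq_of_forall_ge_iff fun z => ?_
      simp only [sSup_le_iff, Set.forall_mem_image]
      have : ∀ v : V, v • sSup r ≤ z ↔ ∀ a ∈ r, v • a ≤ z := fun v => by
        rw [(SupLat.isMor_iff _).1 (jt_smul_isMor X Y v) r]
        simp only [sSup_le_iff, Set.forall_mem_image]
      simp only [this]
      exact ⟨fun h a ha v hv => h hv a ha, fun h v hv a ha => h ha hv⟩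
    · intro x y
      rw [jt_smul_tmul, X.sSup_smul]
      refine ((SupLat.isBim_iff _).1 (jtmul_bim X Y)).2 _ _ |>.trans ?_
      rw [Set.image_image]
      simp only [jt_smul_tmul]

theorem jtmul_univ (X Y : VMod V) : IsUniversalBim U X Y (tens X Y) (jtmul X Y) := by
  constructor
  · refine (isBim_iff (Z := tens X Y) (jtmul X Y)).2
      ⟨(SupLat.isBim_iff _).1 (jtmul_bim X Y), fun v x y => ?_, fun v x y => ?_⟩
    · exact (jt_balanced v x y).symm.trans (jt_smul_tmul X Y v x y).symm
    · exact (jt_smul_tmul X Y v x y).symm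
  · intro Z (f : X → Y → Z) hf
    obtain ⟨h1, h3, h4⟩ := (isBim_iff f).1 hf
    obtain ⟨h, hh⟩ := jt_lift (X := X) (Y := Y) (Z := Z.toSup) f ((SupLat.isBim_iff _).2 h1)
      (fun v x y => (h4 v x y).trans (h3 v x y).symm)
    have hs := SupLat.map_sSup h
    have hv : ∀ (v : V) (t : jt X Y), (SupLat.U.map h (v • t : jt X Y) : Z) =
        v • (SupLat.U.map h t : Z) := fun v t =>
      jt_isMor_ext (Z := Z.toSup) (f := fun t => (SupLat.U.map h (v • t : jt X Y) : Z))
        (g := fun t => v • (SupLat.U.map h t : Z))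
        ((IsMor.of_hom h).comp (jt_smul_isMor X Y v)) ((Z.smul_bim.1 v).comp (IsMor.of_hom h))
        (fun x y => by
          refine (congrArg _ (jt_smul_tmul X Y v x y)).trans ?_
          refine (hh _ _).trans ((h4 v x y).trans ?_)
          exact congrArg (fun z : Z => v • z) (hh x y).symm) t
    refine ⟨(⟨h, hv⟩ : Hom (tens X Y) Z), hh, fun k hk => ?_⟩
    have : (k : Hom (tens X Y) Z).tosSupHom = h :=
      jt_ext (Z := Z.toSup) (f := (k : Hom (tens X Y) Z).tosSupHom) (g := h)
        fun x y => (hk x y).trans (hh x y).symm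
    apply Hom.ext
    intro t
    exact congrArg (fun l : sSupHom (tens X Y) Z => l t) this

section IHom

variable (X Y : VMod V)

instance : SupSet (Hom X Y) where
  sSup F := ⟨sSup (Hom.tosSupHom '' F), fun v x => by
    change (sSup (Hom.tosSupHom '' F)) (v • x) = v • (sSup (Hom.tosSupHom '' F)) x
    rw [SupLat.sSup_hom_apply, SupLat.sSup_hom_apply, iSup_image, iSup_image, ← sSup_image,
      ← sSup_image, Y.smul_sSup, Set.image_image]
    congr 1
    apply Set.image_congr
    intro f _
    exact f.map_smul v x⟩

instance : PartialOrder (Hom X Y) :=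
  PartialOrder.lift Hom.tosSupHom fun f g h => by cases f; cases g; cases h; rfl

instance : CompleteLattice (Hom X Y) := completeLatticeOfSup _ fun F => by
  constructor
  · intro f hf
    exact (le_sSup (Set.mem_image_of_mem Hom.tosSupHom hf) :
      f.tosSupHom ≤ sSup (Hom.tosSupHom '' F))
  · intro g hg
    refine (sSup_le ?_ : sSup (Hom.tosSupHom '' F) ≤ g.tosSupHom)
    rintro _ ⟨f, hf, rfl⟩
    exact hg hf

theorem sSup_apply (F : Set (Hom X Y)) (x : X) :
    (sSup F).toFun x = sSup ((fun f : Hom X Y => f.toFun x) '' F) := by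
  change (sSup (Hom.tosSupHom '' F)) x = _
  rw [SupLat.sSup_hom_apply, iSup_image, ← sSup_image]
  rfl

instance : MulAction V (Hom X Y) where
  smul v f := ⟨⟨fun x => v • f.toFun x, fun s => by
    rw [f.map_sSup', Y.smul_sSup, Set.image_image]⟩, fun w x => by
    change v • f.toFun (w • x) = w • v • f.toFun x
    rw [f.map_smul, smul_comm]⟩
  one_smul f := Hom.ext fun x => one_smul V (f.toFun x)
  mul_smul v w f := Hom.ext fun x => mul_smul v w (f.toFun x)

/-- The internal hom of `V`-modules, with pointwise suprema and action. -/
def ihom : VMod V where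
  carrier := Hom X Y
  smul_sSup v F := Hom.ext fun x => by
    change v • (sSup F).toFun x = _
    rw [sSup_apply, sSup_apply, Y.smul_sSup, Set.image_image, Set.image_image]
    rfl
  sSup_smul s f := Hom.ext fun x => by
    change sSup s • f.toFun x = _
    rw [sSup_apply, Y.sSup_smul, Set.image_image]
    rfl

end IHom

theorem closed (Y Z : VMod V) :
    ∃ (H : VMod V) (ev : U.obj H → U.obj Y → U.obj Z), IsBim U H Y Z ev ∧
    (∀ a b, (∀ y, ev a y = ev b y) → a = b) ∧
    ∀ (W : VMod V) (f : U.obj W → U.obj Y → U.obj Z), IsBim U W Y Z f →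
      ∃ h : W ⟶ H, ∀ w y, ev (U.map h w) y = f w y := by
  refine ⟨ihom Y Z, fun (h : Hom Y Z) y => h.toFun y, ?_, fun a b h => Hom.ext h, ?_⟩
  · exact (isBim_iff (X := ihom Y Z) _).2 ⟨⟨fun h => h.map_sSup', fun y F => sSup_apply Y Z F y⟩,
      fun v h y => h.map_smul v y, fun v h y => rfl⟩
  · intro W (f : W → Y → Z) hf
    obtain ⟨⟨h1, h2⟩, h3, h4⟩ := (isBim_iff f).1 hf
    let c : W → Hom Y Z := fun w => ⟨⟨f w, h1 w⟩, fun v y => h3 v w y⟩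
    obtain ⟨h, hh⟩ := (isMor_iff (X := W) (Y := ihom Y Z) c).2
      ⟨fun s => Hom.ext fun y => by
        refine (h2 y s).trans ?_
        refine Eq.trans ?_ (sSup_apply Y Z _ y).symm
        exact congrArg sSup (Set.image_image (fun k : Hom Y Z => k.toFun y) c s).symm, fun v w => Hom.ext fun y => h4 v w y⟩
    exact ⟨h, fun w y => congrArg (fun k : Hom Y Z => k.toFun y) (hh w)⟩

variable [IsQuantale V]

variable (V) in
/-- `V` as a module over itself. -/
def self : VMod V where
  carrier := V
  smul_sSup v s := by rw [sSup_image]; exact mul_sSup_distrib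
  sSup_smul s x := by rw [sSup_image]; exact sSup_mul_distrib

/-- The Joyal–Tierney tensor product with its universal bimorphism and the unit `V`. -/
noncomputable def tensorData : TensorData (U (V := V)) where
  tens := tens
  tmul := jtmul
  univ := jtmul_univ
  closed := closed
  unit := self V
  one := (1 : V)
  act X := fun (v : V) (x : X) => v • x
  act_bim X := (isBim_iff (X := self V) (Y := X) (Z := X) _).2
    ⟨⟨fun v s => X.smul_sSup v s, fun x s => X.sSup_smul s x⟩,
      fun v (w : V) (x : X) => smul_comm w v x,
        fun v (w : V) (x : X) => mul_smul v w x⟩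
  one_act X x := one_smul V (x : X)
  unit_ext X f g h := by
    apply hom_ext_app (U := U)
    intro (v : V)
    have hv : ∀ f : self V ⟶ X, (U.map f v : X) = v • (U.map f (1 : V) : X) := fun f => by
      refine Eq.trans ?_ (map_smul f v (1 : V))
      exact congrArg _ (mul_one v).symm
    rw [hv f, hv g]
    exact congrArg (fun z : X => v • z) h

noncomputable instance : MonoidalCategory (VMod V) := tensorData.monoidal

end VMod

end Modules

section MonadCoequalizers

variable (T : CategoryTheory.Monad (Type u))

theorem algebra_coeq_exists {A B : T.Algebra} (f g : A ⟶ B) :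
    ∃ (Q : T.Algebra) (p : B ⟶ Q), f ≫ p = g ≫ p ∧
      ∀ (Z : T.Algebra) (h : B ⟶ Z), f ≫ h = g ≫ h → ∃! k : Q ⟶ Z, p ≫ k = h := by
  let r : Setoid B.A :=
    { r := fun a b => ∀ (Z : T.Algebra) (h : B ⟶ Z), f ≫ h = g ≫ h → h.f a = h.f b
      iseqv := ⟨fun _ _ _ _ => rfl, fun h Z k hk => (h Z k hk).symm,
        fun h1 h2 Z k hk => (h1 Z k hk).trans (h2 Z k hk)⟩ }
  let p : B.A ⟶ Quotient r := TypeCat.ofHom (Quotient.mk r)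
  let s : Quotient r ⟶ B.A := TypeCat.ofHom Quotient.out
  have hsp : s ≫ p = 𝟙 _ := by
    ext q
    exact Quotient.out_eq q
  have hout : ∀ (b : B.A) (Z : T.Algebra) (h : B ⟶ Z), f ≫ h = g ≫ h →
      h.f (s (p b)) = h.f b := fun b => Quotient.exact (Quotient.out_eq (Quotient.mk r b))
  have hps : ∀ (Z : T.Algebra) (h : B ⟶ Z), f ≫ h = g ≫ h → p ≫ s ≫ h.f = h.f := by
    intro Z h hh
    ext b
    exact hout b Z h hh
  have key : T.map p ≫ T.map s ≫ B.a ≫ p = B.a ≫ p := by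
    ext t
    refine Quotient.sound (s := r) fun Z h hh => ?_
    have : T.map p ≫ T.map s ≫ B.a ≫ h.f = B.a ≫ h.f := by
      rw [← h.h, ← T.map_comp_assoc, ← T.map_comp_assoc, Category.assoc, hps Z h hh]
    exact congrArg (fun k : T.obj B.A ⟶ Z.A => k t) this
  let Q : T.Algebra :=
    { A := Quotient r
      a := T.map s ≫ B.a ≫ p
      unit := by
        have h : s ≫ T.η.app B.A = T.η.app (Quotient r) ≫ T.map s := T.η.naturality s
        rw [← Category.assoc, ← h, Category.assoc, B.unit_assoc, hsp]
      assoc := by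
        have h : T.map (T.map s) ≫ T.μ.app B.A = T.μ.app (Quotient r) ≫ T.map s :=
          T.μ.naturality s
        rw [← Category.assoc, ← h, Category.assoc, B.assoc_assoc, T.map_comp, T.map_comp, Category.assoc, Category.assoc]
        exact congrArg (fun k => T.map (T.map s) ≫ T.map B.a ≫ k) key.symm }
  let P : B ⟶ Q := ⟨p, key⟩
  refine ⟨Q, P, ?_, fun Z h hh => ?_⟩
  · apply Monad.Algebra.Hom.ext'
    ext a
    refine Quotient.sound (s := r) fun Z h hh => ?_
    exact congrArg (fun k : A ⟶ Z => k.f a) hh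
  · have hk : T.map (s ≫ h.f) ≫ Z.a = Q.a ≫ s ≫ h.f := by
      change _ = (T.map s ≫ B.a ≫ p) ≫ s ≫ h.f
      simp only [Category.assoc, hps Z h hh]
      rw [← h.h, T.map_comp_assoc]
    let k : Q ⟶ Z := ⟨s ≫ h.f, hk⟩
    refine ⟨k, ?_, fun k' hk' => ?_⟩
    · apply Monad.Algebra.Hom.ext'
      exact hps Z h hh
    · apply Monad.Algebra.Hom.ext'
      have h1 : p ≫ k'.f = h.f := congrArg (fun l : B ⟶ Z => l.f) hk'
      change k'.f = s ≫ h.f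
      rw [← h1, ← Category.assoc, hsp]
      exact (Category.id_comp _).symm

instance : Limits.HasCoequalizers T.Algebra := by
  refine @Limits.hasCoequalizers_of_hasColimit_parallelPair _ _ fun {A B f g} => ?_
  obtain ⟨Q, p, hp, hu⟩ := algebra_coeq_exists T f g
  exact ⟨⟨⟨Limits.Cofork.ofπ p hp, Limits.Cofork.IsColimit.mk _
    (fun s => (hu s.pt s.π s.condition).choose)
    (fun s => (hu s.pt s.π s.condition).choose_spec.1)
    (fun s m hm => (hu s.pt s.π s.condition).choose_spec.2 m hm)⟩⟩⟩

end MonadCoequalizers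

section Algebras

variable {V : Type u} [CommMonoid V] [CompleteLattice V] [IsQuantale V]

theorem mul_iSup' {ι : Sort*} (v : V) (f : ι → V) : v * ⨆ i, f i = ⨆ i, v * f i := by
  rw [iSup, mul_sSup_distrib, iSup_range]

theorem iSup_mul' {ι : Sort*} (v : V) (f : ι → V) : (⨆ i, f i) * v = ⨆ i, f i * v := by
  rw [iSup, sSup_mul_distrib, iSup_range]

/-- `P_V f φ y = ⋁_{f x = y} φ x`. -/
def pmap {X Y : Type u} (f : X → Y) (φ : X → V) (y : Y) : V := ⨆ x, ⨆ _ : f x = y, φ x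

/-- `u x x' = k` if `x = x'`, and `⊥` otherwise. -/
def punit {X : Type u} (x x' : X) : V := ⨆ _ : x = x', 1

/-- `n Φ x = ⋁_φ Φ φ ⊗ φ x`. -/
def pmul {X : Type u} (Φ : (X → V) → V) (x : X) : V := ⨆ φ, Φ φ * φ x

set_option linter.unusedSectionVars false

theorem iSup_pmap_mul {X Y : Type u} (f : X → Y) (φ : X → V) (g : Y → V) :
    ⨆ y, pmap f φ y * g y = ⨆ x, φ x * g (f x) := by
  simp only [pmap, iSup_mul']
  rw [iSup_comm]
  simp

theorem iSup_punit_mul {X : Type u} (x : X) (g : X → V) : ⨆ y, punit x y * g y = g x := by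
  simp only [punit, iSup_mul', one_mul]
  simp

theorem iSup_mul_punit {X : Type u} (φ : X → V) (y : X) : ⨆ x, φ x * punit x y = φ y := by
  simp only [punit, mul_iSup', mul_one]
  simp

theorem iSup_pmul_mul {X : Type u} (Φ : (X → V) → V) (g : X → V) :
    ⨆ x, pmul Φ x * g x = ⨆ φ, Φ φ * ⨆ x, φ x * g x := by
  simp only [pmul, iSup_mul', mul_iSup', mul_assoc]
  rw [iSup_comm]

theorem pmap_id {X : Type u} (φ : X → V) : pmap (fun x => x) φ = φ := by
  funext y
  simp [pmap]

theorem pmap_pmap {X Y Z : Type u} (f : X → Y) (g : Y → Z) (φ : X → V) :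
    pmap g (pmap f φ) = pmap (fun x => g (f x)) φ := by
  funext z
  refine eq_of_forall_ge_iff fun v => ?_
  simp only [pmap, iSup_le_iff]
  exact ⟨fun h x hx => h (f x) hx x rfl, fun h y hy x hx => h x (by rw [hx, hy])⟩

theorem pmap_punit {X Y : Type u} (f : X → Y) (x : X) :
    pmap f (punit x : X → V) = punit (f x) := by
  funext y
  refine eq_of_forall_ge_iff fun v => ?_
  simp only [pmap, punit, iSup_le_iff]
  exact ⟨fun h hy => h x hy rfl, fun h x' hx' hx => h (by rw [hx, hx'])⟩

theorem pmul_pmap {X Y : Type u} (f : X → Y → V) (φ : X → V) :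
    pmul (pmap f φ) = fun y => ⨆ x, φ x * f x y := by
  funext y
  exact iSup_pmap_mul f φ (fun ψ => ψ y)

theorem pmul_nat {X Y : Type u} (f : X → Y) (Φ : (X → V) → V) :
    pmul (pmap (pmap f) Φ) = pmap f (pmul Φ) := by
  rw [pmul_pmap]
  funext y
  simp only [pmap, pmul, mul_iSup']
  rw [iSup_comm]
  refine iSup_congr fun x => ?_
  rw [iSup_comm]

theorem pmul_punit {X : Type u} (φ : X → V) : pmul (punit φ) = φ := by
  funext x
  exact iSup_punit_mul φ (fun ψ => ψ x)

theorem pmul_pmap_punit {X : Type u} (φ : X → V) : pmul (pmap punit φ) = φ := by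
  rw [pmul_pmap]
  funext x
  exact iSup_mul_punit φ x

theorem pmul_assoc {X : Type u} (Ψ : ((X → V) → V) → V) :
    pmul (pmap pmul Ψ) = pmul (pmul Ψ) := by
  rw [pmul_pmap]
  funext x
  exact (iSup_pmul_mul Ψ (fun φ => φ x)).symm

variable (V) in
/-- The `V`-powerset monad `P_V X = V^X`. -/
def powMonad : CategoryTheory.Monad (Type u) where
  obj X := X → V
  map f := TypeCat.ofHom (pmap f)
  map_id X := by
    apply TypeCat.Hom.ext
    exact TypeCat.Fun.ext (funext fun φ => pmap_id φ)
  map_comp {X Y Z} f g := by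
    apply TypeCat.Hom.ext
    exact TypeCat.Fun.ext (funext fun φ => (pmap_pmap f g φ).symm)
  η := { app X := TypeCat.ofHom punit
         naturality X Y f := by
          apply TypeCat.Hom.ext
          exact TypeCat.Fun.ext (funext fun x => (pmap_punit f x).symm) }
  μ := { app X := TypeCat.ofHom pmul
         naturality X Y f := by
          apply TypeCat.Hom.ext
          exact TypeCat.Fun.ext (funext fun Φ => pmul_nat f Φ) }
  left_unit X := by
    apply TypeCat.Hom.ext
    exact TypeCat.Fun.ext (funext fun φ => pmul_punit φ)
  right_unit X := by
    apply TypeCat.Hom.ext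
    exact TypeCat.Fun.ext (funext fun φ => pmul_pmap_punit φ)
  assoc X := by
    apply TypeCat.Hom.ext
    exact TypeCat.Fun.ext (funext fun Ψ => pmul_assoc Ψ)

variable (V) in
/-- The Eilenberg–Moore category of the `V`-powerset monad. -/
abbrev Alg : Type (u + 1) := (powMonad V).Algebra

namespace Alg

/-- The underlying set. -/
abbrev U : Alg V ⥤ Type u where
  obj A := A.A
  map f := f.f

instance : (U (V := V)).Faithful where
  map_injective {_ _} _ _ h := Monad.Algebra.Hom.ext h

/-- The structure map `P_V A → A` as a function. -/
def str (A : Alg V) (φ : A.A → V) : A.A := A.a φ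

theorem str_punit (A : Alg V) (x : A.A) : A.str (punit x) = x :=
  congrArg (fun k : A.A ⟶ A.A => k x) A.unit

theorem str_pmul (A : Alg V) (Φ : (A.A → V) → V) : A.str (pmul Φ) = A.str (pmap A.str Φ) :=
  congrArg (fun k : ((powMonad V).obj ((powMonad V).obj A.A)) ⟶ A.A => k Φ) A.assoc

theorem map_str {A B : Alg V} (f : A ⟶ B) (φ : A.A → V) :
    U.map f (A.str φ) = B.str (pmap (fun x => U.map f x) φ) :=
  (congrArg (fun k : ((powMonad V).obj A.A) ⟶ B.A => k φ) f.h).symm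

/-- An algebra from a structure map. -/
def ofStr (A : Type u) (s : (A → V) → A) (h1 : ∀ x, s (punit x) = x)
    (h2 : ∀ Φ, s (pmul Φ) = s (pmap s Φ)) : Alg V where
  A := A
  a := TypeCat.ofHom s
  unit := by
    apply TypeCat.Hom.ext
    exact TypeCat.Fun.ext (funext h1)
  assoc := by
    apply TypeCat.Hom.ext
    exact TypeCat.Fun.ext (funext h2)

theorem isMor_iff {A B : Alg V} (f : A.A → B.A) :
    IsMor U A B f ↔ ∀ φ : A.A → V, f (A.str φ) = B.str (pmap f φ) := by
  constructor
  · rintro ⟨h, hh⟩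
    obtain rfl : (fun x => U.map h x) = f := funext hh
    exact map_str h
  · intro hf
    refine ⟨⟨TypeCat.ofHom f, ?_⟩, fun _ => rfl⟩
    apply TypeCat.Hom.ext
    exact TypeCat.Fun.ext (funext fun φ => (hf φ).symm)

theorem isBim_iff {X Y Z : Alg V} (f : X.A → Y.A → Z.A) : IsBim U X Y Z f ↔
    (∀ (x : X.A) (ψ : Y.A → V), f x (Y.str ψ) = Z.str (pmap (f x) ψ)) ∧
      ∀ (y : Y.A) (φ : X.A → V), f (X.str φ) y = Z.str (pmap (fun x => f x y) φ) :=
  ⟨fun h => ⟨fun x => (isMor_iff _).1 (h.1 x), fun y => (isMor_iff _).1 (h.2 y)⟩,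
   fun h => ⟨fun x => (isMor_iff _).2 (h.1 x), fun y => (isMor_iff _).2 (h.2 y)⟩⟩

/-- Associativity of weighted suprema. -/
theorem str_wsum (A : Alg V) {ι : Type u} (w : ι → V) (φ : ι → A.A → V) :
    A.str (pmap (fun i => A.str (φ i)) w) = A.str (fun a => ⨆ i, w i * φ i a) := by
  rw [← pmul_pmap, str_pmul, pmap_pmap]

/-- The double strength `φ ⊠ ψ`. -/
def dst {X Y : Type u} (p : (X → V) × (Y → V)) : X × Y → V := fun q => p.1 q.1 * p.2 q.2

theorem pmap_dst {X Y Z : Type u} (f : X → Y → Z) (φ : X → V) (ψ : Y → V) :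
    pmap (fun q : X × Y => f q.1 q.2) (dst (φ, ψ)) = fun z => ⨆ x, φ x * pmap (f x) ψ z := by
  funext z
  simp only [pmap, dst, iSup_prod, mul_iSup']

theorem dst_punit {X Y : Type u} (x : X) (ψ : Y → V) :
    dst (punit x, ψ) = pmap (fun y => (x, y)) ψ := by
  funext q
  refine eq_of_forall_ge_iff fun v => ?_
  simp only [dst, punit, pmap, iSup_mul', one_mul, iSup_le_iff]
  constructor
  · rintro h y rfl
    exact h rfl
  · rintro h rfl
    exact h _ rfl

theorem dst_punit' {X Y : Type u} (φ : X → V) (y : Y) :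
    dst (φ, punit y) = pmap (fun x => (x, y)) φ := by
  funext q
  refine eq_of_forall_ge_iff fun v => ?_
  simp only [dst, punit, pmap, mul_iSup', mul_one, iSup_le_iff]
  constructor
  · rintro h x rfl
    exact h rfl
  · rintro h rfl
    exact h _ rfl

variable (V) in
/-- The free algebra `P_V X`. -/
abbrev free (X : Type u) : Alg V := (powMonad V).free.obj X

theorem free_ext {X : Type u} {A : Alg V} {f g : free V X ⟶ A}
    (h : ∀ x : X, U.map f (punit x : X → V) = U.map g (punit x : X → V)) : f = g := by
  apply hom_ext_app (U := U)
  intro (φ : X → V)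
  have key : ∀ f : free V X ⟶ A,
      U.map f φ = A.str (pmap (fun x => U.map f (punit x : X → V)) φ) := by
    intro f
    have := map_str f (pmap punit φ)
    refine Eq.trans ?_ (this.trans (congrArg A.str
      (pmap_pmap punit (fun ψ : X → V => U.map f ψ) φ)))
    exact congrArg (fun ψ : X → V => U.map f ψ) (pmul_pmap_punit φ).symm
  rw [key f, key g]
  congr 2
  funext x
  exact h x

/-- The morphism `P_V X ⟶ A` extending a function. -/
theorem free_lift {X : Type u} {A : Alg V} (f : X → A.A) :
    ∃ h : free V X ⟶ A, ∀ φ : X → V, U.map h φ = A.str (pmap f φ) := by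
  refine (isMor_iff (A := free V X) (fun φ : X → V => A.str (pmap f φ))).2
    fun (Φ : (X → V) → V) => ?_
  change A.str (pmap f (pmul Φ)) = A.str (pmap (fun φ : X → V => A.str (pmap f φ)) Φ)
  rw [← pmul_nat, str_pmul, pmap_pmap]

/-- `P_V (P_V X × P_V Y) ⟶ P_V (X × Y)`: `P_V` of the double strength, followed by the
multiplication of the monad. -/
def tensLeft (X Y : Alg V) : free V ((X.A → V) × (Y.A → V)) ⟶ free V (X.A × Y.A) :=
  (powMonad V).free.map (TypeCat.ofHom dst : ((X.A → V) × (Y.A → V)) ⟶ ((X.A × Y.A) → V)) ≫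
    (powMonad V).adj.counit.app (free V (X.A × Y.A))

/-- `P_V (P_V X × P_V Y) ⟶ P_V (X × Y)`: `P_V` of the product of the structure maps. -/
def tensRight (X Y : Alg V) : free V ((X.A → V) × (Y.A → V)) ⟶ free V (X.A × Y.A) :=
  (powMonad V).free.map (TypeCat.ofHom (fun p => (X.str p.1, Y.str p.2)))

theorem tensLeft_punit (X Y : Alg V) (φ : X.A → V) (ψ : Y.A → V) :
    U.map (tensLeft X Y) (punit (φ, ψ) : (X.A → V) × (Y.A → V) → V) = dst (φ, ψ) := by
  have : U.map (tensLeft X Y) (punit (φ, ψ) : (X.A → V) × (Y.A → V) → V) =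
      pmul (pmap dst (punit (φ, ψ))) := by
    refine (map_comp_app _ _ _).trans ?_
    simp only [Monad.adj_counit]
    rfl
  rw [this, pmap_punit, pmul_punit]

theorem tensRight_punit (X Y : Alg V) (φ : X.A → V) (ψ : Y.A → V) :
    U.map (tensRight X Y) (punit (φ, ψ) : (X.A → V) × (Y.A → V) → V) =
      (punit (X.str φ, Y.str ψ) : X.A × Y.A → V) :=
  pmap_punit _ _

/-- The tensor product of algebras. -/
noncomputable def tens (X Y : Alg V) : Alg V := Limits.coequalizer (tensLeft X Y) (tensRight X Y)

noncomputable def tensπ (X Y : Alg V) : free V (X.A × Y.A) ⟶ tens X Y :=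
  Limits.coequalizer.π (tensLeft X Y) (tensRight X Y)

/-- The pure tensor `x ⊗ y`. -/
noncomputable def tmul (X Y : Alg V) (x : X.A) (y : Y.A) : (tens X Y).A :=
  U.map (tensπ X Y) (punit (x, y) : X.A × Y.A → V)

theorem tensπ_dst (X Y : Alg V) (φ : X.A → V) (ψ : Y.A → V) :
    U.map (tensπ X Y) (dst (φ, ψ)) = tmul X Y (X.str φ) (Y.str ψ) := by
  have h := congrArg (fun k => U.map k (punit (φ, ψ) : (X.A → V) × (Y.A → V) → V))
    (Limits.coequalizer.condition (tensLeft X Y) (tensRight X Y))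
  have h' := (map_comp_app _ _ _).symm.trans (h.trans (map_comp_app _ _ _))
  refine (congrArg _ (tensLeft_punit X Y φ ψ)).symm.trans (h'.trans ?_)
  exact congrArg _ (tensRight_punit X Y φ ψ)

theorem tensπ_apply (X Y : Alg V) (Φ : X.A × Y.A → V) :
    U.map (tensπ X Y) Φ = (tens X Y).str (pmap (fun p => tmul X Y p.1 p.2) Φ) := by
  have := map_str (tensπ X Y) (pmap punit Φ)
  refine Eq.trans ?_ (this.trans (congrArg (tens X Y).str
    (pmap_pmap punit (fun ψ : X.A × Y.A → V => U.map (tensπ X Y) ψ) Φ)))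
  exact congrArg (fun ψ : X.A × Y.A → V => U.map (tensπ X Y) ψ) (pmul_pmap_punit Φ).symm

theorem tmul_univ (X Y : Alg V) : IsUniversalBim U X Y (tens X Y) (tmul X Y) := by
  constructor
  · refine (isBim_iff (Z := tens X Y) _).2 ⟨fun x ψ => ?_, fun y φ => ?_⟩
    · have := tensπ_dst X Y (punit x) ψ
      rw [str_punit, dst_punit] at this
      rw [← this, tensπ_apply, pmap_pmap]
    · have := tensπ_dst X Y φ (punit y)
      rw [str_punit, dst_punit'] at this
      rw [← this, tensπ_apply, pmap_pmap]
  · intro Z f hf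
    obtain ⟨h1, h2⟩ := (isBim_iff f).1 hf
    obtain ⟨h, hh⟩ := free_lift (V := V) (A := Z) (fun p : X.A × Y.A => f p.1 p.2)
    have hc : tensLeft X Y ≫ h = tensRight X Y ≫ h := by
      refine free_ext fun ⟨φ, ψ⟩ => ?_
      refine (map_comp_app _ _ _).trans (Eq.trans ?_ (map_comp_app _ _ _).symm)
      refine (congrArg _ (tensLeft_punit X Y φ ψ)).trans
        (Eq.trans ?_ (congrArg _ (tensRight_punit X Y φ ψ)).symm)
      refine (hh _).trans (Eq.trans ?_ (hh _).symm)
      rw [pmap_punit, str_punit, h2]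
      simp only [h1]
      rw [str_wsum, pmap_dst]
    refine ⟨Limits.coequalizer.desc h hc, fun x y => ?_, fun k hk => ?_⟩
    · have h3 : tensπ X Y ≫ Limits.coequalizer.desc h hc = h := Limits.coequalizer.π_desc _ _
      refine (map_comp_app (tensπ X Y) _ _).symm.trans ?_
      rw [h3]
      refine (hh _).trans ?_
      rw [pmap_punit, str_punit]
    · apply Limits.coequalizer.hom_ext
      rw [Limits.coequalizer.π_desc]
      refine free_ext fun ⟨x, y⟩ => ?_
      refine (map_comp_app _ _ _).trans ((hk x y).trans (Eq.trans ?_ (hh _).symm))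
      rw [pmap_punit, str_punit]

section IHom

variable (Y Z : Alg V)

/-- The pointwise structure on morphisms. -/
theorem ihom_isMor (Φ : (Y ⟶ Z) → V) :
    IsMor U Y Z (fun y => Z.str (pmap (fun h : Y ⟶ Z => U.map h y) Φ)) := by
  refine (isMor_iff _).2 fun ψ => ?_
  have h1 : (fun h : Y ⟶ Z => U.map h (Y.str ψ)) =
      fun h => Z.str (pmap (fun y => U.map h y) ψ) := funext fun h => map_str h ψ
  rw [h1, str_wsum]
  refine Eq.trans ?_ (str_wsum Z ψ (fun y => pmap (fun h : Y ⟶ Z => U.map h y) Φ)).symm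
  congr 1
  funext z
  simp only [pmap, mul_iSup']
  rw [iSup_comm]
  refine iSup_congr fun y => iSup_congr fun h => iSup_congr fun _ => mul_comm _ _

/-- The internal hom of algebras. -/
noncomputable def ihom : Alg V :=
  ofStr (Y ⟶ Z) (fun Φ => (ihom_isMor Y Z Φ).choose)
    (fun h => hom_ext_app (U := U) fun y => by
      refine ((ihom_isMor Y Z (punit h)).choose_spec y).trans ?_
      change Z.str (pmap (fun h : Y ⟶ Z => U.map h y) (punit h)) = _
      rw [pmap_punit, str_punit])
    (fun Ψ => hom_ext_app (U := U) fun y => by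
      refine ((ihom_isMor Y Z _).choose_spec y).trans
        (Eq.trans ?_ ((ihom_isMor Y Z _).choose_spec y).symm)
      change Z.str (pmap (fun h : Y ⟶ Z => U.map h y) (pmul Ψ)) =
        Z.str (pmap (fun h : Y ⟶ Z => U.map h y) (pmap _ Ψ))
      rw [← pmul_nat, str_pmul, pmap_pmap, pmap_pmap]
      congr 2
      funext Φ
      exact ((ihom_isMor Y Z Φ).choose_spec y).symm)

theorem ihom_str (Φ : (Y ⟶ Z) → V) (y : Y.A) :
    U.map ((ihom Y Z).str Φ : Y ⟶ Z) y = Z.str (pmap (fun h : Y ⟶ Z => U.map h y) Φ) :=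
  (ihom_isMor Y Z Φ).choose_spec y

theorem closed :
    ∃ (H : Alg V) (ev : U.obj H → U.obj Y → U.obj Z), IsBim U H Y Z ev ∧
    (∀ a b, (∀ y, ev a y = ev b y) → a = b) ∧
    ∀ (W : Alg V) (f : U.obj W → U.obj Y → U.obj Z), IsBim U W Y Z f →
      ∃ h : W ⟶ H, ∀ w y, ev (U.map h w) y = f w y := by
  refine ⟨ihom Y Z, fun (h : Y ⟶ Z) y => U.map h y, ?_, fun a b h => hom_ext_app (U := U) h, ?_⟩
  · exact ⟨fun h => ⟨h, fun _ => rfl⟩, fun y =>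
      (isMor_iff (A := ihom Y Z) (B := Z) _).2 fun Φ => ihom_str Y Z Φ y⟩
  · intro W f hf
    choose c hc using hf.1
    obtain ⟨h, hh⟩ := (isMor_iff (A := W) (B := ihom Y Z) c).2 fun φ =>
      hom_ext_app (U := U) fun y => by
        refine (hc _ y).trans (Eq.trans ?_ (ihom_str Y Z (pmap c φ) y).symm)
        refine (((isBim_iff f).1 hf).2 y φ).trans ?_
        rw [pmap_pmap]
        congr 2
        funext w
        exact (hc w y).symm
    exact ⟨h, fun w y => (congrArg (fun k : Y ⟶ Z => U.map k y) (hh w)).trans (hc w y)⟩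

end IHom

/-- The tensor product of algebras with its universal bimorphism and the unit `P_V 1`. -/
noncomputable def tensorData : TensorData (U (V := V)) where
  tens := tens
  tmul := tmul
  univ := tmul_univ
  closed := closed
  unit := free V PUnit
  one := (punit PUnit.unit : PUnit → V)
  act X := fun (v : PUnit → V) (x : X.A) => X.str (fun x' => v PUnit.unit * punit x x')
  act_bim X := by
    refine (isBim_iff (X := free V PUnit) (Y := X) (Z := X) _).2
      ⟨fun (v : PUnit → V) φ => ?_, fun x Φ => ?_⟩
    · rw [str_wsum]
      have h := str_wsum X v (fun _ => φ)
      have h2 : pmap (fun _ => X.str φ) v = fun x' => v PUnit.unit * punit (X.str φ) x' := by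
        funext x'
        simp [pmap, punit, mul_iSup']
      rw [h2] at h
      rw [h]
      congr 1
      funext a
      have : ∀ x, φ x * (v PUnit.unit * punit x a) = v PUnit.unit * (φ x * punit x a) :=
        fun x => mul_left_comm _ _ _
      simp only [this, ← mul_iSup', iSup_mul_punit]
      simp
    · refine Eq.trans ?_ (str_wsum X _ _).symm
      change X.str (fun x' => pmul Φ PUnit.unit * punit x x') = _
      congr 1
      funext a
      simp only [pmul, iSup_mul', mul_assoc]
      rfl
  one_act X x := by
    have : (fun x' => (punit PUnit.unit : PUnit → V) PUnit.unit * punit x x') = punit x := by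
      funext x'
      simp [punit]
    exact (congrArg X.str this).trans (str_punit X x)
  unit_ext X f g h := free_ext fun ⟨⟩ => h

noncomputable instance : MonoidalCategory (Alg V) := tensorData.monoidal

end Alg

end Algebras

section Comparison

variable {V : Type u} [CommMonoid V] [CompleteLattice V] [IsQuantale V]

set_option linter.unusedSectionVars false

namespace VMod

/-- The `V`-category structure `a` of a `V`-module: `v ≤ a(x, y) ↔ v • x ≤ y`. -/
def vHom (X : VMod V) (x y : X) : V := sSup {v | v • x ≤ y}

/-- The left adjoint `Sup_X` of the Yoneda embedding `x ↦ a(-, x)`: the least `x` with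
`φ ≤ a(-, x)`. -/
def presheafSup (X : VMod V) (φ : X → V) : X := sInf {x | ∀ w, φ w ≤ X.vHom w x}

/-- The `P_V`-algebra structure `ψ ↦ Sup_X (ψ ∘ a)` of a `V`-module, where
`(ψ ∘ a) w = ⋁_x a(w, x) ⊗ ψ x`. -/
def algStr (X : VMod V) (ψ : X → V) : X :=
  X.presheafSup (fun w => ⨆ x, X.vHom w x * ψ x)

theorem smul_mono_left (X : VMod V) {v w : V} (h : v ≤ w) (x : X) : v • x ≤ w • x := by
  have := X.sSup_smul {v, w} x
  rw [sSup_pair, sup_eq_right.2 h, Set.image_pair, sSup_pair] at this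
  rw [this]
  exact le_sup_left

theorem smul_mono_right (X : VMod V) (v : V) {x y : X} (h : x ≤ y) : v • x ≤ v • y := by
  have := X.smul_sSup v {x, y}
  rw [sSup_pair, sup_eq_right.2 h, Set.image_pair, sSup_pair] at this
  rw [this]
  exact le_sup_left

theorem le_vHom (X : VMod V) (v : V) (x y : X) : v ≤ X.vHom x y ↔ v • x ≤ y := by
  constructor
  · intro h
    refine (X.smul_mono_left h x).trans ?_
    rw [vHom, X.sSup_smul, sSup_le_iff]
    rintro _ ⟨w, hw, rfl⟩
    exact hw
  · intro h
    exact le_sSup h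

theorem iSup_smul (X : VMod V) {ι : Sort*} (f : ι → V) (x : X) :
    (⨆ i, f i) • x = ⨆ i, f i • x := by
  rw [iSup, X.sSup_smul, sSup_image, iSup_range]

theorem smul_iSup (X : VMod V) {ι : Sort*} (v : V) (f : ι → X) :
    v • (⨆ i, f i) = ⨆ i, v • f i := by
  rw [iSup, X.smul_sSup, sSup_image, iSup_range]

theorem algStr_eq (X : VMod V) (ψ : X → V) : X.algStr ψ = ⨆ x, ψ x • x := by
  have hset : {x | ∀ w, (⨆ x', X.vHom w x' * ψ x') ≤ X.vHom w x} =
      {x | (⨆ x', ψ x' • x') ≤ x} := by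
    ext x
    change (∀ w, (⨆ x', X.vHom w x' * ψ x') ≤ X.vHom w x) ↔ (⨆ x', ψ x' • x') ≤ x
    simp only [le_vHom, iSup_smul, iSup_le_iff]
    constructor
    · intro h x'
      refine le_trans ?_ (h x' x')
      refine X.smul_mono_left ?_ x'
      have : (1 : V) ≤ X.vHom x' x' := (X.le_vHom 1 x' x').2 (one_smul V x').le
      calc ψ x' = 1 * ψ x' := (one_mul _).symm
        _ ≤ X.vHom x' x' * ψ x' := by
          have h2 := iSup_mul' (ψ x') (fun b : Bool => if b then (1 : V) else X.vHom x' x')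
          have h3 : (⨆ b : Bool, if b then (1 : V) else X.vHom x' x') = X.vHom x' x' := by
            rw [iSup_bool_eq]; simpa using this
          rw [h3] at h2
          rw [h2, iSup_bool_eq]
          simp
    · intro h w x'
      rw [mul_comm, mul_smul]
      exact (X.smul_mono_right _ ((X.le_vHom _ _ _).1 le_rfl)).trans (h x')
  rw [algStr, presheafSup, hset]
  exact isGLB_Ici.sInf_eq

theorem iSup_pmap_smul (X : VMod V) {ι : Type u} (w : ι → V) (f : ι → X) :
    ⨆ x, pmap f w x • x = ⨆ i, w i • f i := by
  refine eq_of_forall_ge_iff fun z => ?_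
  simp only [iSup_le_iff]
  have : ∀ x, pmap f w x • x ≤ z ↔ ∀ i, f i = x → w i • x ≤ z := fun x => by
    simp only [pmap, iSup_smul, iSup_le_iff]
  simp only [this]
  exact ⟨fun h i => h _ i rfl, fun h x i hi => hi ▸ h i⟩

/-- The `P_V`-algebra `[X]` of a `V`-module `X`. -/
def toAlg (X : VMod V) : Alg V :=
  Alg.ofStr X X.algStr
    (fun x => by
      rw [algStr_eq]
      refine eq_of_forall_ge_iff fun z => ?_
      simp only [iSup_le_iff]
      have : ∀ y, (punit x y : V) • y ≤ z ↔ (x = y → y ≤ z) := fun y => by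
        simp only [punit, iSup_smul, iSup_le_iff, one_smul]
      simp only [this]
      exact ⟨fun h => h x rfl, fun h y hy => hy ▸ h⟩)
    (fun Φ => by
      rw [algStr_eq, algStr_eq, iSup_pmap_smul]
      simp only [algStr_eq, pmul, iSup_smul, smul_iSup, mul_smul]
      exact iSup_comm)

end VMod

variable (V) in
/-- The comparison functor `[-]` from `V`-modules to `P_V`-algebras. It is the identity on
underlying sets and functions. -/
def bracket : VMod V ⥤ Alg V where
  obj X := X.toAlg
  map {X Y} f :=
    { f := TypeCat.ofHom fun x : X => (VMod.U.map f x : Y)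
      h := by
        apply TypeCat.Hom.ext
        refine TypeCat.Fun.ext (funext fun (φ : X → V) => ?_)
        change Y.algStr (pmap (fun x : X => (VMod.U.map f x : Y)) φ) =
          (VMod.U.map f (X.algStr φ) : Y)
        rw [Y.algStr_eq, X.algStr_eq, Y.iSup_pmap_smul]
        refine Eq.trans ?_ (VMod.map_sSup f (Set.range fun x : X => φ x • x)).symm
        rw [← Set.range_comp]
        refine congrArg sSup (congrArg Set.range (funext fun x => ?_))
        exact (VMod.map_smul f (φ x) x).symm }

end Comparison

end QuantaleMod

open CategoryTheory MonoidalCategory QuantaleMod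

/-! A `P_V`-algebra is a set with weighted suprema: its structure map should be read as `φ ↦ ⋁ φ(x)
· x`, and its axioms amount to the unit law `Alg.str_punit` and the associativity of weighted
suprema, `Alg.str_wsum`. A weight that is the indicator of a subset gives a plain supremum, and a
weight concentrated at one point gives a scalar multiple. Associativity turns these two operations
into a `V`-module. Conversely every weight is the pointwise supremum of its values times points, so
the two operations determine the structure map (`Alg.toVMod_algStr`). Hence `[-]` is essentially
surjective. It is full because a function that preserves weighted suprema preserves the two special
kinds, and faithful because it does not change functions; the precise form is
`VMod.bracket_isMor_iff`.

Universality of the two tensor products is a matter of what the coequalizers impose. For modules it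
is the balancing condition, which every bimorphism satisfies; equivariance of the induced map is
then checked on pure tensors. For algebras it is compatibility with `φ ⊠ ψ`, which gives
preservation in each variable when the other weight is a point, and follows from it by
associativity.

The monoidal comparison is formal from there. Which functions are bimorphisms depends only on which
functions are morphisms, so `[-]` preserves and reflects bimorphisms, hence preserves universal ones
(`bracket_isUniversalBim`). Two universal bimorphisms on the same pair have isomorphic targets,
which gives `[X] ⊗ [Y] ≅ [X ⊗ Y]`, and coherence is an equality of values on pure tensors. Finally,
a strong monoidal equivalence induces an equivalence on monoids, since a monoid structure can be
transported along an isomorphism and lifted through a fully faithful functor. -/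

namespace QuantaleMod

/-! ### The `V`-module structure of a `P_V`-algebra. -/

namespace Alg

variable {V : Type u} [CommMonoid V] [CompleteLattice V] [IsQuantale V]

/-- The supremum of a subset of a `P_V`-algebra: the value of the structure map at the
characteristic function. -/
def join (A : Alg V) (s : Set A.A) : A.A := A.str (fun a => ⨆ _ : a ∈ s, 1)

/-- The action of `V` on a `P_V`-algebra. -/
def scale (A : Alg V) (v : V) (x : A.A) : A.A := A.str (fun a => v * punit x a)

/-- The indicator of the range is the pushforward of the constant weight `1`. This is what makes
`str_wsum` applicable to joins. -/
theorem join_range (A : Alg V) {ι : Type u} (f : ι → A.A) :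
    A.join (Set.range f) = A.str (pmap f (fun _ => (1 : V))) := by
  unfold join
  congr 1
  funext a
  refine eq_of_forall_ge_iff fun v => ?_
  simp [pmap]

/-- Associativity of weighted suprema with all weights equal to the unit. Every later identity
between joins is reduced by it to an identity between functions into `V`. -/
theorem join_range_str (A : Alg V) {ι : Type u} (φ : ι → A.A → V) :
    A.join (Set.range fun i => A.str (φ i)) = A.str (fun a => ⨆ i, φ i a) := by
  rw [join_range, str_wsum]
  simp only [one_mul]

/-- Associativity of weighted suprema over a one-point index set of weight `v`. -/
theorem scale_str (A : Alg V) (v : V) (φ : A.A → V) :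
    A.scale v (A.str φ) = A.str (fun a => v * φ a) := by
  have h := A.str_wsum (fun _ : PUnit.{u + 1} => v) (fun _ => φ)
  simp only [ciSup_const] at h
  rw [← h, scale]
  congr 1
  funext a
  simp [pmap, punit, mul_iSup']

/-- The indicator of a union is the pointwise supremum of the indicators. -/
theorem join_iUnion (A : Alg V) {ι : Type u} (s : ι → Set A.A) :
    A.join (Set.range fun i => A.join (s i)) = A.join (⋃ i, s i) := by
  refine (A.join_range_str _).trans ?_
  unfold join
  congr 1
  funext a
  refine eq_of_forall_ge_iff fun v => ?_
  simp

theorem join_singleton (A : Alg V) (x : A.A) : A.join {x} = x := by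
  refine Eq.trans ?_ (A.str_punit x)
  unfold join
  congr 1
  funext a
  simp only [punit, Set.mem_singleton_iff, eq_comm]

theorem join_pair_join (A : Alg V) (s t : Set A.A) :
    A.join {A.join s, A.join t} = A.join (s ∪ t) := by
  -- `ULift` puts the two-element index set into the universe of the algebra.
  have h := A.join_iUnion (fun b : ULift.{u} Bool => if b.down then s else t)
  have h1 : (⋃ b : ULift.{u} Bool, if b.down then s else t) = s ∪ t := by
    ext a
    simp [or_comm]
  have h2 : (Set.range fun b : ULift.{u} Bool => A.join (if b.down then s else t)) =
      {A.join s, A.join t} := by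
    ext a
    constructor
    · rintro ⟨⟨_ | _⟩, rfl⟩ <;> simp
    · rintro (rfl | rfl)
      · exact ⟨⟨true⟩, rfl⟩
      · exact ⟨⟨false⟩, rfl⟩
  rwa [h1, h2] at h

theorem join_pair_left (A : Alg V) (s : Set A.A) (x : A.A) :
    A.join {A.join s, x} = A.join (s ∪ {x}) := by
  rw [← A.join_pair_join, A.join_singleton]

/-- The order of a `P_V`-algebra. -/
@[reducible]
def partialOrder (A : Alg V) : PartialOrder A.A where
  le x y := A.join {x, y} = y
  le_refl x := by
    rw [Set.pair_eq_singleton, join_singleton]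
  le_trans x y z (hxy : A.join {x, y} = y) (hyz : A.join {y, z} = z) := by
    -- The join of the three elements is computed in two ways: absorbing `y` into `z` first gives
    -- the join of `x` and `z`, and absorbing `x` into `y` first gives `z`.
    have h1 := A.join_pair_left {y, z} x
    have h2 := A.join_pair_left {x, y} z
    rw [hyz, Set.pair_comm] at h1
    rw [hxy, hyz] at h2
    rw [h1]
    refine Eq.trans ?_ h2.symm
    congr 1
    ext a
    simp
    tauto
  le_antisymm x y (hxy : A.join {x, y} = y) (hyx : A.join {y, x} = x) := by
    rw [← hyx, Set.pair_comm, hxy]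

/-- Adding a member of `s` to `s` changes nothing, so the join is an upper bound. For an upper bound
`b`, the set `s ∪ {b}` is a union of sets each having join `b`, so its join is `b` as well. -/
theorem isLUB_join (A : Alg V) (s : Set A.A) :
    letI := A.partialOrder
    IsLUB s (A.join s) := by
  let := A.partialOrder
  constructor
  · intro a ha
    change A.join {a, A.join s} = A.join s
    rw [Set.pair_comm, join_pair_left, Set.union_singleton, Set.insert_eq_of_mem ha]
  · intro b hb
    change A.join {A.join s, b} = b
    have hb' : ∀ a ∈ s, A.join {a, b} = b := fun a ha => hb ha
    rw [join_pair_left]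
    -- The pairs `{a, b}` alone would not cover `{b}` when `s` is empty; the index `none`
    -- contributes it.
    have h := A.join_iUnion (fun i : Option s => i.elim {b} (fun a => {a.1, b}))
    have h1 : (⋃ i : Option s, (i.elim {b} (fun a => {a.1, b}) : Set A.A)) = s ∪ {b} := by
      ext a
      simp only [Set.iUnion_option, Option.elim_none, Option.elim_some, Set.mem_union,
        Set.mem_singleton_iff, Set.mem_iUnion, Set.mem_insert_iff, Subtype.exists, exists_prop]
      grind
    have h2 : ∀ i : Option s, A.join (i.elim {b} (fun a => {a.1, b})) = b := by
      rintro (_ | a)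
      · exact A.join_singleton b
      · exact hb' a.1 a.2
    rw [h1] at h
    rw [← h]
    simp only [h2, Set.range_const, join_singleton]

/-- The complete lattice underlying a `P_V`-algebra. -/
@[reducible]
def completeLattice (A : Alg V) : CompleteLattice A.A :=
  letI := A.partialOrder
  letI : SupSet A.A := ⟨A.join⟩
  completeLatticeOfSup A.A A.isLUB_join

/-- The `V`-module underlying a `P_V`-algebra. -/
def toVMod (A : Alg V) : VMod V :=
  letI : CompleteLattice A.A := A.completeLattice
  letI : MulAction V A.A :=
    { smul := A.scale
      one_smul := fun x => by
        change A.scale 1 x = x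
        simp only [scale, one_mul]
        exact A.str_punit x
      mul_smul := fun v w x => by
        change A.scale (v * w) x = A.scale v (A.str _)
        rw [scale_str]
        simp only [scale, mul_assoc] }
  { carrier := A.A
    smul_sSup := fun v s => by
      -- The supremum of the lattice is `join` and the action is `scale` by definition. Both sides
      -- become values of the structure map, and the weights agree because the indicator of `s` is
      -- the supremum of its points and the product of `V` distributes over it.
      change A.scale v (A.str _) = A.join (A.scale v '' s)
      have h := A.join_range_str (fun (x : s) a => v * (punit x.1 a : V))
      have h' : (Set.range fun x : s => A.str fun a => v * (punit x.1 a : V)) =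
          A.scale v '' s := by
        rw [Set.image_eq_range]
        rfl
      rw [← h', h, scale_str]
      congr 1
      funext a
      rw [← mul_iSup']
      congr 1
      refine eq_of_forall_ge_iff fun z => ?_
      simp only [punit, iSup_le_iff, Subtype.forall]
      exact ⟨fun h b hb hba => h (hba ▸ hb), fun h ha => h a ha rfl⟩
    sSup_smul := fun s x => by
      -- The same reduction; here the product of `V` distributes over the supremum of scalars.
      change A.scale (sSup s) x = A.join ((fun v => A.scale v x) '' s)
      have h := A.join_range_str (fun (v : s) a => v.1 * (punit x a : V))
      have h' : (Set.range fun v : s => A.str fun a => v.1 * (punit x a : V)) =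
          (fun v => A.scale v x) '' s := by
        rw [Set.image_eq_range]
        rfl
      rw [← h', h, scale]
      congr 1
      funext a
      rw [← iSup_mul', sSup_eq_iSup'] }

/-- Any weight `ψ` is the supremum over `x` of `ψ x` times the point `x`, so the structure map is
recovered from joins and scalar multiples. This is the essential surjectivity of `[-]`. -/
theorem toVMod_algStr (A : Alg V) (ψ : A.A → V) : A.toVMod.algStr ψ = A.str ψ := by
  refine (A.toVMod.algStr_eq ψ).trans ?_
  change A.join (Set.range fun x => A.str fun a => ψ x * punit x a) = _
  rw [join_range_str]
  congr 1
  funext a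
  exact iSup_mul_punit ψ a

/-- Every `P_V`-algebra comes from a `V`-module. -/
def bracketToVModIso (A : Alg V) : (bracket V).obj A.toVMod ≅ A :=
  Monad.Algebra.isoMk (Iso.refl A.A) (by
    apply TypeCat.Hom.ext
    refine TypeCat.Fun.ext (funext fun ψ : A.A → V => ?_)
    change A.str (pmap (fun x => x) ψ) = A.toVMod.algStr ψ
    rw [pmap_id, toVMod_algStr])

end Alg

/-! ### Morphisms and bimorphisms of modules as those of algebras. -/

namespace VMod

variable {V : Type u} [CommMonoid V] [CompleteLattice V] [IsQuantale V]

/-- Together with `algStr_mul_punit`, this expresses the module operations through the structure map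
of `[X]`, so that whatever respects the latter respects the former. -/
theorem algStr_indicator (X : VMod V) (s : Set X) :
    X.algStr (fun x => ⨆ _ : x ∈ s, 1) = sSup s := by
  rw [algStr_eq]
  refine eq_of_forall_ge_iff fun z => ?_
  simp [iSup_smul]

theorem algStr_mul_punit (X : VMod V) (v : V) (x : X) :
    X.algStr (fun y => v * punit x y) = v • x := by
  rw [algStr_eq]
  refine eq_of_forall_ge_iff fun z => ?_
  simp [punit, mul_iSup', iSup_smul]

/-- Suprema and scalar multiples are values of the structure map at particular weights, and pushing
those weights forward along `f` gives the corresponding operation in `Y`. The converse is the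
functor itself. -/
theorem bracket_isMor_iff {X Y : VMod V} (f : X → Y) :
    IsMor Alg.U ((bracket V).obj X) ((bracket V).obj Y) f ↔ IsMor U X Y f := by
  constructor
  · intro h
    have h' : ∀ φ : X → V, f (X.algStr φ) = Y.algStr (pmap f φ) :=
      (Alg.isMor_iff (A := (bracket V).obj X) (B := (bracket V).obj Y) f).1 h
    refine (isMor_iff f).2 ⟨fun s => ?_, fun v x => ?_⟩
    · rw [← algStr_indicator, h', algStr_eq, iSup_pmap_smul]
      refine eq_of_forall_ge_iff fun z => ?_
      simp [iSup_smul]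
    · rw [← algStr_mul_punit, h', algStr_eq, iSup_pmap_smul]
      refine eq_of_forall_ge_iff fun z => ?_
      simp [punit, mul_iSup', iSup_smul]
  · rintro ⟨h, hh⟩
    exact ⟨(bracket V).map h, hh⟩

theorem bracket_isBim_iff {X Y Z : VMod V} (f : X → Y → Z) :
    IsBim Alg.U ((bracket V).obj X) ((bracket V).obj Y) ((bracket V).obj Z) f ↔
      IsBim U X Y Z f :=
  ⟨fun h => ⟨fun x => (bracket_isMor_iff (X := Y) (Y := Z) _).1 (h.1 x),
    fun y => (bracket_isMor_iff (X := X) (Y := Z) _).1 (h.2 y)⟩,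
   fun h => ⟨fun x => (bracket_isMor_iff (X := Y) (Y := Z) _).2 (h.1 x),
    fun y => (bracket_isMor_iff (X := X) (Y := Z) _).2 (h.2 y)⟩⟩

end VMod

/-! ### The equivalence of categories. -/

section Bracket

variable {V : Type u} [CommMonoid V] [CompleteLattice V] [IsQuantale V]

instance : (bracket V).Faithful where
  map_injective {X Y} _ _ h := hom_ext_app (U := VMod.U) fun x =>
    congrArg (fun k : (bracket V).obj X ⟶ (bracket V).obj Y => Alg.U.map k x) h

instance : (bracket V).Full where
  map_surjective {X Y} g := by
    obtain ⟨h, hh⟩ := (VMod.bracket_isMor_iff (X := X) (Y := Y) _).1 (IsMor.of_hom g)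
    exact ⟨h, hom_ext_app (U := Alg.U) hh⟩

instance : (bracket V).EssSurj where
  mem_essImage A := ⟨A.toVMod, ⟨A.bracketToVModIso⟩⟩

instance : (bracket V).IsEquivalence where

end Bracket

/-! ### The strong monoidal structure. -/

section BracketMonoidal

variable {V : Type u} [CommMonoid V] [CompleteLattice V] [IsQuantale V]

theorem IsBim.postcomp {C : Type (u + 1)} [Category.{u} C] {U : C ⥤ Type u} {X Y Z W : C}
    {f : U.obj X → U.obj Y → U.obj Z} (hf : IsBim U X Y Z f) (g : Z ⟶ W) :
    IsBim U X Y W (fun x y => U.map g (f x y)) :=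
  ⟨fun x => (IsMor.of_hom g).comp (hf.1 x), fun y => (IsMor.of_hom g).comp (hf.2 y)⟩

/-- The functor `[-]` preserves universal bimorphisms. -/
theorem bracket_isUniversalBim {X Y T : VMod V} {t : X → Y → T}
    (ht : IsUniversalBim VMod.U X Y T t) :
    IsUniversalBim Alg.U ((bracket V).obj X) ((bracket V).obj Y) ((bracket V).obj T) t := by
  refine ⟨(VMod.bracket_isBim_iff t).2 ht.isBim, fun Z f hf => ?_⟩
  -- The target is an arbitrary algebra, so the bimorphism is first moved along `Z ≅ [Z.toVMod]`,
  -- where universality among modules applies. This isomorphism is the identity on elements, so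
  -- moving back does not change values.
  have hf' := (VMod.bracket_isBim_iff (Z := Z.toVMod) _).1 (hf.postcomp Z.bracketToVModIso.inv)
  obtain ⟨h, hh, hu⟩ := ht.existsUnique _ _ hf'
  refine ⟨(bracket V).map h ≫ Z.bracketToVModIso.hom, fun x y => ?_, fun k hk => ?_⟩
  · exact hh x y
  -- By fullness any competing factorization comes from a module morphism, to which uniqueness among
  -- modules applies.
  · obtain ⟨k', hk'⟩ := (bracket V).map_surjective (k ≫ Z.bracketToVModIso.inv)
    rw [← Iso.comp_inv_eq, ← hk', hu k' fun x y => ?_]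
    refine (congrArg (fun l => Alg.U.map l (t x y)) hk').trans ?_
    exact hk x y

/-- Both morphisms factor the bimorphism obtained by composing `t` with `g`. -/
theorem IsUniversalBim.hom_ext {C : Type (u + 1)} [Category.{u} C] {U : C ⥤ Type u}
    {X Y T Z : C} {t : U.obj X → U.obj Y → U.obj T} (ht : IsUniversalBim U X Y T t)
    {f g : T ⟶ Z} (h : ∀ x y, U.map f (t x y) = U.map g (t x y)) : f = g :=
  (ht.existsUnique Z _ (ht.isBim.postcomp g)).unique h (fun _ _ => rfl)

/-- The isomorphism between the targets of two universal bimorphisms. -/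
noncomputable def IsUniversalBim.uniqueIso {C : Type (u + 1)} [Category.{u} C] {U : C ⥤ Type u}
    {X Y T T' : C} {t : U.obj X → U.obj Y → U.obj T} {t' : U.obj X → U.obj Y → U.obj T'}
    (ht : IsUniversalBim U X Y T t) (ht' : IsUniversalBim U X Y T' t') : T ≅ T' where
  hom := (ht.existsUnique _ _ ht'.isBim).choose
  inv := (ht'.existsUnique _ _ ht.isBim).choose
  hom_inv_id := ht.hom_ext fun x y => by
    rw [map_comp_app, (ht.existsUnique _ _ ht'.isBim).choose_spec.1,
      (ht'.existsUnique _ _ ht.isBim).choose_spec.1, map_id_app]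
  inv_hom_id := ht'.hom_ext fun x y => by
    rw [map_comp_app, (ht'.existsUnique _ _ ht.isBim).choose_spec.1,
      (ht.existsUnique _ _ ht'.isBim).choose_spec.1, map_id_app]

theorem IsUniversalBim.uniqueIso_hom_app {C : Type (u + 1)} [Category.{u} C] {U : C ⥤ Type u}
    {X Y T T' : C} {t : U.obj X → U.obj Y → U.obj T} {t' : U.obj X → U.obj Y → U.obj T'}
    (ht : IsUniversalBim U X Y T t) (ht' : IsUniversalBim U X Y T' t') (x : U.obj X)
    (y : U.obj Y) : U.map (ht.uniqueIso ht').hom (t x y) = t' x y :=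
  (ht.existsUnique _ _ ht'.isBim).choose_spec.1 x y

/-- The isomorphism `[X] ⊗ [Y] ≅ [X ⊗ Y]`, `x ⊗ y ↦ x ⊗ y`. -/
noncomputable def bracketμIso (X Y : VMod V) :
    (bracket V).obj X ⊗ (bracket V).obj Y ≅ (bracket V).obj (X ⊗ Y) :=
  (Alg.tmul_univ _ _).uniqueIso (bracket_isUniversalBim (VMod.jtmul_univ X Y))

theorem bracketμIso_tmul (X Y : VMod V) (x : X) (y : Y) :
    Alg.U.map (bracketμIso X Y).hom
      (Alg.tmul ((bracket V).obj X) ((bracket V).obj Y) x y) = VMod.jtmul X Y x y :=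
  (Alg.tmul_univ _ _).uniqueIso_hom_app (bracket_isUniversalBim (VMod.jtmul_univ X Y)) x y

variable (V) in
/-- The isomorphism `P_V 1 ≅ [V]`, `φ ↦ φ *`. -/
def bracketεIso : 𝟙_ (Alg V) ≅ (bracket V).obj (𝟙_ (VMod V)) :=
  Monad.Algebra.isoMk (A := Alg.free V PUnit) (B := (bracket V).obj (VMod.self V))
    (Equiv.toIso (Equiv.funUnique PUnit V)) (by
      apply TypeCat.Hom.ext
      refine TypeCat.Fun.ext (funext fun Φ : (PUnit → V) → V => ?_)
      change (VMod.self V).algStr (pmap (fun φ : PUnit → V => φ PUnit.unit) Φ) =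
        pmul Φ PUnit.unit
      -- The action of `V` on itself is multiplication, so the weighted supremum in `[V]` is `⋁_φ Φ
      -- φ ⊗ φ *`, which is the multiplication of the monad evaluated at the point.
      refine ((VMod.self V).algStr_eq _).trans ?_
      exact (VMod.self V).iSup_pmap_smul Φ (fun φ : PUnit → V => φ PUnit.unit))

theorem bracketεIso_apply (φ : PUnit → V) :
    Alg.U.map (bracketεIso V).hom φ = φ PUnit.unit := rfl

/-- This and the next two lemmas hold because the monoidal structure unfolds to `tensorData`; they
put its formulas on pure tensors into monoidal notation for the coherence proofs. -/
theorem Alg.whiskerRight_tmul {X X' : Alg V} (f : X ⟶ X') (Y : Alg V) (x : X.A) (y : Y.A) :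
    Alg.U.map (f ▷ Y) (Alg.tmul X Y x y) = Alg.tmul X' Y (Alg.U.map f x) y :=
  Alg.tensorData.map_tmul f (𝟙 Y) x y

theorem Alg.whiskerLeft_tmul {Y Y' : Alg V} (X : Alg V) (g : Y ⟶ Y') (x : X.A) (y : Y.A) :
    Alg.U.map (X ◁ g) (Alg.tmul X Y x y) = Alg.tmul X Y' x (Alg.U.map g y) :=
  Alg.tensorData.map_tmul (𝟙 X) g x y

theorem Alg.associator_tmul (X Y Z : Alg V) (x : X.A) (y : Y.A) (z : Z.A) :
    Alg.U.map (α_ X Y Z).hom (Alg.tmul (X ⊗ Y) Z (Alg.tmul X Y x y) z) =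
      Alg.tmul X (Y ⊗ Z) x (Alg.tmul Y Z y z) :=
  Alg.tensorData.assoc_tmul x y z

/-- Since `[-]` does not change functions, this and the next two lemmas are the formulas for modules
read in algebras. -/
theorem bracket_map_whiskerRight_tmul {X X' : VMod V} (f : X ⟶ X') (Y : VMod V) (x : X) (y : Y) :
    Alg.U.map ((bracket V).map (f ▷ Y)) (VMod.jtmul X Y x y) =
      VMod.jtmul X' Y (VMod.U.map f x) y :=
  VMod.tensorData.map_tmul f (𝟙 Y) x y

theorem bracket_map_whiskerLeft_tmul (X : VMod V) {Y Y' : VMod V} (g : Y ⟶ Y') (x : X) (y : Y) :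
    Alg.U.map ((bracket V).map (X ◁ g)) (VMod.jtmul X Y x y) =
      VMod.jtmul X Y' x (VMod.U.map g y) :=
  VMod.tensorData.map_tmul (𝟙 X) g x y

theorem bracket_map_associator_tmul (X Y Z : VMod V) (x : X) (y : Y) (z : Z) :
    Alg.U.map ((bracket V).map (α_ X Y Z).hom) (VMod.jtmul (X ⊗ Y) Z (VMod.jtmul X Y x y) z) =
      VMod.jtmul X (Y ⊗ Z) x (VMod.jtmul Y Z y z) :=
  VMod.tensorData.assoc_tmul x y z

variable (V) in
/-- The strong monoidal structure of the functor `[-]`. -/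
noncomputable def bracketCoreMonoidal : (bracket V).CoreMonoidal where
  εIso := bracketεIso V
  μIso := bracketμIso
  μIso_hom_natural_left {X Y} f Z := Alg.tensorData.ext2 fun x z => by
    rw [map_comp_app, map_comp_app]
    refine (congrArg _ (Alg.whiskerRight_tmul _ _ x z)).trans ?_
    refine (bracketμIso_tmul Y Z _ z).trans
      (Eq.trans ?_ (congrArg _ (bracketμIso_tmul X Z x z)).symm)
    exact (bracket_map_whiskerRight_tmul f Z x z).symm
  μIso_hom_natural_right {X Y} Z f := Alg.tensorData.ext2 fun z x => by
    rw [map_comp_app, map_comp_app]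
    refine (congrArg _ (Alg.whiskerLeft_tmul _ _ z x)).trans ?_
    refine (bracketμIso_tmul Z Y z _).trans
      (Eq.trans ?_ (congrArg _ (bracketμIso_tmul Z X z x)).symm)
    exact (bracket_map_whiskerLeft_tmul Z f z x).symm
  -- It suffices to compare values on `(x ⊗ y) ⊗ z`; both composites give `x ⊗ (y ⊗ z)`.
  associativity X Y Z := Alg.tensorData.ext3 fun x y z => by
    refine (congrArg _ ((congrArg _ ((Alg.whiskerRight_tmul _ _ _ z).trans
      (congrArg (fun t => Alg.tmul _ _ t z) (bracketμIso_tmul X Y x y)))).trans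
        (bracketμIso_tmul (X ⊗ Y) Z _ z))).trans ?_
    refine (bracket_map_associator_tmul X Y Z x y z).trans (Eq.symm ?_)
    refine (congrArg _ ((congrArg _ (Alg.associator_tmul _ _ _ x y z)).trans
      ((Alg.whiskerLeft_tmul _ _ x _).trans
      (congrArg (fun t => Alg.tmul _ _ x t) (bracketμIso_tmul Y Z y z))))).trans ?_
    exact bracketμIso_tmul X (Y ⊗ Z) x _
  -- The unitor of algebras applies the structure map of `[X]` to the weight `i *` at the point `x`,
  -- and the other composite gives `i * • x`. These agree by `algStr_mul_punit`, and likewise for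
  -- the right unitor.
  left_unitality X := Alg.tensorData.ext2 fun (i : PUnit → V) x => by
    refine (Alg.tensorData.leftU_tmul (X := (bracket V).obj X) i x).trans (Eq.symm ?_)
    refine (congrArg _ ((congrArg _ (Alg.whiskerRight_tmul (bracketεIso V).hom _ i x)).trans
        (bracketμIso_tmul (𝟙_ _) X _ x))).trans ?_
    refine (VMod.tensorData.leftU_tmul (X := X) (i PUnit.unit) x).trans ?_
    exact (X.algStr_mul_punit (i PUnit.unit) x).symm
  right_unitality X := Alg.tensorData.ext2 fun x (i : PUnit → V) => by
    refine (Alg.tensorData.rightU_tmul (X := (bracket V).obj X) x i).trans (Eq.symm ?_)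
    refine (congrArg _ ((congrArg _ (Alg.whiskerLeft_tmul _ (bracketεIso V).hom x i)).trans
        (bracketμIso_tmul X (𝟙_ _) x _))).trans ?_
    refine (VMod.tensorData.rightU_tmul (X := X) x (i PUnit.unit)).trans ?_
    exact (X.algStr_mul_punit (i PUnit.unit) x).symm

end BracketMonoidal

/-! ### Monoids, and the proposition. -/

/-- Fullness and faithfulness pass to monoids by instances. A monoid lies in the essential image as
soon as its underlying object does: its structure is transported along the isomorphism and lifted
because `F` is fully faithful. -/
theorem mapMon_isEquivalence {C D : Type*} [Category C] [Category D] [MonoidalCategory C]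
    [MonoidalCategory D] (F : C ⥤ D) [F.Monoidal] [F.IsEquivalence] :
    F.mapMon.IsEquivalence where
  essSurj := ⟨fun _ => Functor.essImage_mapMon.2 (Functor.EssSurj.mem_essImage F _)⟩

end QuantaleMod

theorem mainTheorem4 (V : Type u) [CommMonoid V] [CompleteLattice V] [IsQuantale V] :
    (∀ X Y : VMod V, IsUniversalBim VMod.U X Y (X ⊗ Y) (VMod.jtmul X Y)) ∧
    (∀ X Y : Alg V, IsUniversalBim Alg.U X Y (X ⊗ Y) (Alg.tmul X Y)) ∧
    (bracket V).IsEquivalence ∧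
    ∃ _ : (bracket V).Monoidal,
      (∀ (X Y : VMod V) (x : X) (y : Y),
        Alg.U.map (Functor.LaxMonoidal.μ (bracket V) X Y)
          (Alg.tmul ((bracket V).obj X) ((bracket V).obj Y) x y) = VMod.jtmul X Y x y) ∧
      (∀ φ : PUnit → V, Alg.U.map (Functor.LaxMonoidal.ε (bracket V)) φ = φ PUnit.unit) ∧
      (bracket V).mapMon.IsEquivalence := by
  -- In both categories `X ⊗ Y` is by definition the coequalizer `tens X Y`, so the universality
  -- already proved applies as it stands.
  refine ⟨VMod.jtmul_univ, Alg.tmul_univ, inferInstance, (bracketCoreMonoidal V).toMonoidal,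
    bracketμIso_tmul, bracketεIso_apply, ?_⟩
  -- The functor on monoids depends on the monoidal structure, so the one just supplied as witness
  -- is made the instance.
  let := (bracketCoreMonoidal V).toMonoidal
  exact mapMon_isEquivalence (bracket V)
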